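/- Let $N=\sum_{l=1}^{L}N_l$ sensors be divided into $L$ groups, sensor $(k,l)$ being the $k$-th of the $N_l$ sensors of group $l$. Sensor $(k,l)$ observes $X^{k,l}_t$, $t=1,2,\dots$; all observations are independent, and under $P_\nu$ ($\nu\in\{0,1,2,\dots\}\cup\{\infty\}$) the variable $X^{k,l}_t$ has law $f_l$ for $t\le\nu$ and law $g_l$ for $t>\nu$. Assume that the Kullback–Leibler divergences $\mathcal I_l=D(g_l\|f_l)$ satisfy $0<\mathcal I_l<\infty$ and $\mathcal I_1\le\dots\le\mathcal I_L$. Let $Z^{k,l}_t=\log\frac{dg_l}{df_l}(X^{k,l}_t)$ and let the local CUSUM statistics be $W^{k,l}_0=0$, $W^{k,l}_t=\max\{0,W^{k,l}_{t-1}\}+Z^{k,l}_t$. For $1\le M\le N$ and a threshold vector $\mathbf h=(h_1,\dots,h_L)$ define the $M$-th alarm rule and the $M$ voting rule by $$\rho^{(M)}(\mathbf h)=\inf\Big\{t\ge 1:\ \big|\{(k,l):\max_{1\le s\le t}W^{k,l}_s>h_l\}\big|\ge M\Big\},\qquad \rho_M(\mathbf h)=\inf\Big\{t\ge 1:\ \big|\{(k,l):W^{k,l}_t>h_l\}\big|\ge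 M\Big\}.$$ Define $\lambda:\{1,\dots,N\}\to\{1,\dots,L\}$ by $\lambda(m)=l$ if $\sum_{j<l}N_j<m\le\sum_{j\le l}N_j$. Take $\mathbf h=(\mathcal I_1h,\dots,\mathcal I_Lh)$, and suppose that $h=h_{\gamma,1}$ and $h=h_{\gamma,2}$ lead to $E_\infty[\rho^{(M)}(\mathbf h)]=\gamma$ and $E_\infty[\rho_M(\mathbf h)]=\gamma$, respectively. Then, as $\gamma\to\infty$ (through all large $\gamma$ or, if these equations are solvable for some $\gamma$ only, through such $\gamma$), $$h_{\gamma,1}\sim\frac{\log\gamma}{\mathcal I_{\lambda(M)}},\qquad h_{\gamma,2}\sim\frac{\log\gamma}{\sum_{m=1}^{M}\mathcal I_{\lambda(m)}}.$$ Furthermore, with $h=h_{\gamma,1}$ and $h=h_{\gamma,2}$ respectively, the expected delays are finite for all large $\gamma$ and $$E_0[\rho^{(M)}(\mathbf h)]\sim\frac{\log\gamma}{\mathcal I_{\lambda(M)}},\qquad E_0[\rho_M(\mathbf h)]\sim\frac{\log\gamma}{\sum_{m=1}^{M}\mathcal I_{\lambda(m)}}.$$ -/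

import Mathlib

open MeasureTheory ProbabilityTheory Filter Asymptotics InformationTheory
open scoped ENNReal Topology

namespace HetQCD

/-- The sensors: a pair `⟨l, k⟩` is the `k`-th sensor of group `l`, and group `l` has `N l` members. -/
abbrev Sensor {L : ℕ} (N : Fin L → ℕ) : Type := Σ l : Fin L, Fin (N l)

lemma lam_aux {L : ℕ} (N : Fin L → ℕ) (m : Finset.Icc 1 (∑ l, N l)) :
    (Finset.univ.filter fun l : Fin L => (m : ℕ) ≤ ∑ j ∈ Finset.Iic l, N j).Nonempty := by
  obtain ⟨m, hm⟩ := m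
  rw [Finset.mem_Icc] at hm
  rcases L with _ | L
  · simp at hm
    omega
  · refine ⟨Fin.last L, ?_⟩
    have h : Finset.Iic (Fin.last L) = Finset.univ := by
      ext x
      simp [Fin.le_last]
    simp only [Finset.mem_filter, Finset.mem_univ, true_and, h]
    exact hm.2

/-- The map `λ : [∑ N_l] → [L]` which sends `m` to the group that holds the `m`-th sensor when the
sensors are listed group by group: the least `l` with `m ≤ N_1 + ⋯ + N_l`. -/
noncomputable def lam {L : ℕ} (N : Fin L → ℕ) (m : Finset.Icc 1 (∑ l, N l)) : Fin L :=
  (Finset.univ.filter fun l : Fin L => (m : ℕ) ≤ ∑ j ∈ Finset.Iic l, N j).min' (lam_aux N m)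

/-- `λ(m) = l` if and only if `N_1 + ⋯ + N_{l-1} < m ≤ N_1 + ⋯ + N_l`. -/
lemma lam_eq_iff {L : ℕ} (N : Fin L → ℕ) (m : Finset.Icc 1 (∑ l, N l)) (l : Fin L) :
    lam N m = l ↔ ∑ j ∈ Finset.Iio l, N j < (m : ℕ) ∧ (m : ℕ) ≤ ∑ j ∈ Finset.Iic l, N j := by
  have key : ∀ a b : Fin L, a < b → ∑ j ∈ Finset.Iic a, N j ≤ ∑ j ∈ Finset.Iio b, N j := by
    intro a b hab
    refine Finset.sum_le_sum_of_subset fun x hx => ?_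
    simp only [Finset.mem_Iic, Finset.mem_Iio] at hx ⊢
    exact lt_of_le_of_lt hx hab
  have hmem : (m : ℕ) ≤ ∑ j ∈ Finset.Iic (lam N m), N j := by
    exact (Finset.mem_filter.1 (Finset.min'_mem _ (lam_aux N m))).2
  have hmin : ∀ a : Fin L, (m : ℕ) ≤ ∑ j ∈ Finset.Iic a, N j → lam N m ≤ a := by
    intro a ha
    exact Finset.min'_le _ _ (by simpa using ha)
  have hlow : ∑ j ∈ Finset.Iio (lam N m), N j < (m : ℕ) := by
    by_contra! hcon
    have h1 : 1 ≤ (m : ℕ) := (Finset.mem_Icc.1 m.2).1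
    obtain ⟨c, hc⟩ : ∃ c : Fin L, Finset.Iio (lam N m) = Finset.Iic c := by
      rcases Nat.eq_zero_or_pos (lam N m : ℕ) with h0 | h0
      · have : Finset.Iio (lam N m) = ∅ := by
          ext x
          simp [Fin.lt_def, h0]
        rw [this] at hcon
        simp at hcon
        omega
      · refine ⟨⟨(lam N m : ℕ) - 1, by omega⟩, ?_⟩
        ext x
        simp only [Finset.mem_Iio, Finset.mem_Iic, Fin.lt_def, Fin.le_def]
        omega
    have h2 := hmin c (hc ▸ hcon)
    have h3 : c ∈ Finset.Iio (lam N m) := by rw [hc]; simp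
    exact absurd h2 (not_le.2 (Finset.mem_Iio.1 h3))
  constructor
  · rintro rfl
    exact ⟨hlow, hmem⟩
  · rintro ⟨h1, h2⟩
    refine le_antisymm (hmin l h2) (le_of_not_gt fun hlt => ?_)
    exact absurd (hmem.trans (key _ _ hlt)) (not_le.2 h1)

section Model

variable {L : ℕ} {N : Fin L → ℕ} {S : Fin L → Type*} [∀ l, MeasurableSpace (S l)]
  {Ω : Type*} [MeasurableSpace Ω]

/-- The Kullback-Leibler divergence `I_l = D(g_l ‖ f_l)` of the post-change law from the pre-change
law, as a real number. -/
noncomputable def KL (f g : ∀ l, Measure (S l)) (l : Fin L) : ℝ :=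
  (klDiv (g l) (f l)).toReal

/-- `P` is the law with change time `ν` (`ν = ⊤`: no change): the observations `X i t`, over all
sensors `i` and all times `t ≥ 1`, are independent; in group `l` they have law `f l` for `t ≤ ν`
and law `g l` for `t > ν`. The values at time `0` are never used. -/
structure IsChangeModel (f g : ∀ l, Measure (S l)) (X : ∀ i : Sensor N, ℕ → Ω → S i.1)
    (ν : ℕ∞) (P : Measure Ω) : Prop where
  isProbabilityMeasure : IsProbabilityMeasure P
  measurable : ∀ (i : Sensor N) (t : ℕ), 1 ≤ t → Measurable (X i t)
  law_pre : ∀ (i : Sensor N) (t : ℕ), 1 ≤ t → (t : ℕ∞) ≤ ν → P.map (X i t) = f i.1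
  law_post : ∀ (i : Sensor N) (t : ℕ), 1 ≤ t → ν < (t : ℕ∞) → P.map (X i t) = g i.1
  indep : iIndepFun (fun (p : Sensor N × ℕ) => X p.1 (p.2 + 1)) P

/-- The log-likelihood ratio `log (dg/df)`, with values in `[-∞, ∞]`: it is `-∞` where the
density ratio vanishes. -/
noncomputable def LLR {T : Type*} [MeasurableSpace T] (f g : Measure T) (x : T) : EReal :=
  ENNReal.log (g.rnDeriv f x)

/-- The local CUSUM statistic: `W_0 = 0` and `W_t = max {0, W_{t-1}} + Z_t`. -/
noncomputable def cusum (f g : ∀ l, Measure (S l)) (X : ∀ i : Sensor N, ℕ → Ω → S i.1)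
    (i : Sensor N) : ℕ → Ω → EReal
  | 0, _ => 0
  | t + 1, ω => max 0 (cusum f g X i t ω) + LLR (f i.1) (g i.1) (X i (t + 1) ω)

/-- The `M`-th alarm rule `ρ^{(M)}(h)`: the first time `t ≥ 1` by which at least `M` sensors have
had a CUSUM statistic above their threshold at some time up to `t` (`⊤` if there is none). -/
noncomputable def alarmTime (f g : ∀ l, Measure (S l)) (X : ∀ i : Sensor N, ℕ → Ω → S i.1)
    (M : ℕ) (h : Fin L → ℝ) (ω : Ω) : ℕ∞ :=
  ⨅ t ∈ {t : ℕ | 1 ≤ t ∧ M ≤ Set.ncard {i : Sensor N |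
    (h i.1 : EReal) < (Finset.Icc 1 t).sup fun s => cusum f g X i s ω}}, (t : ℕ∞)

/-- The `M` voting rule `ρ_M(h)`: the first time `t ≥ 1` at which at least `M` sensors have their
CUSUM statistic above their threshold simultaneously (`⊤` if there is none). -/
noncomputable def votingTime (f g : ∀ l, Measure (S l)) (X : ∀ i : Sensor N, ℕ → Ω → S i.1)
    (M : ℕ) (h : Fin L → ℝ) (ω : Ω) : ℕ∞ :=
  ⨅ t ∈ {t : ℕ | 1 ≤ t ∧ M ≤ Set.ncard {i : Sensor N |
    (h i.1 : EReal) < cusum f g X i t ω}}, (t : ℕ∞)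

/-- The expectation of a random time under `P`, with values in `[0, ∞]`. -/
noncomputable def expTime (P : Measure Ω) (ρ : Ω → ℕ∞) : ℝ≥0∞ :=
  ∫⁻ ω, (ρ ω : ℝ≥0∞) ∂P

end Model

end HetQCD

/-! Scaling the thresholds by the divergences makes all sensors cross at about the same time after
the change: a post-change CUSUM grows like `a i * t` and so passes `a i * h` near `t = h`. Hence
both delays are asymptotic to `h`, whatever `M` is; the rules differ only in how `h` depends on `γ`.

Without a change, a CUSUM is above `b` at a given time with probability at most `K * exp (-θ * b)`,
for each `θ < 1` (`exists_tail_bound`). For the vote, `M` independent sensors must be high together,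
so exponents add, and the cheapest set `A` consists of the `M` smallest divergences. For the `M`-th
alarm, `M` alarms include one from a sensor with divergence at least the `M`-th smallest, `c`. A
union bound over time gives expected false alarm times of at least about `exp (h * ∑ i ∈ A, a i)`
and `exp (h * c)`.

For the matching upper bounds, time is cut into blocks of length about `h`. By the law of large
numbers and a change of measure, a block lifts all of `A` over the thresholds with probability about
`exp (-h * ∑ i ∈ A, a i)`, and the number of blocks needed is geometric (`expTime_hitTime_le`). The
alarm rule is bounded by a sum of such times for single sensors. Under the post-change law the same
blocks succeed with probability near one, which bounds the delay. Inverting `log γ ~ κ * h` finishes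
the proof (`threshold_and_delay_asymptotics`). -/

namespace HetQCD

/-! ### Exponential CUSUM statistics and likelihood ratios -/

/-- The exponential of the CUSUM recursion, driven by the likelihood ratios `y`. -/
noncomputable def expCusum (y : ℕ → ℝ≥0∞) : ℕ → ℝ≥0∞
  | 0 => 1
  | t + 1 => max 1 (expCusum y t) * y t

lemma measurable_expCusum {Ω : Type*} {m : MeasurableSpace Ω} {y : ℕ → Ω → ℝ≥0∞} {t : ℕ}
    (hy : ∀ s < t, Measurable (y s)) : Measurable fun ω => expCusum (fun s => y s ω) t := by
  induction t with
  | zero => exact measurable_const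
  | succ t ih =>
    exact (measurable_const.max (ih fun s hs => hy s (by omega))).mul (hy t (by omega))

/-- The maximum with `1` can only help: a statistic restarted from `1` at time `m` stays below the
true one. This lets a block of time be judged by its own observations alone. -/
lemma prod_le_max_one_expCusum (y : ℕ → ℝ≥0∞) (m n : ℕ) :
    ∏ s ∈ Finset.range n, y (m + s) ≤ max 1 (expCusum y (m + n)) := by
  induction n with
  | zero => simp
  | succ n ih =>
    rw [Finset.prod_range_succ]
    exact (mul_le_mul_left ih _).trans (le_max_right _ _)

/-- `q₀` and `q₁` are the laws of a likelihood ratio under two different probability measures,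
and the logarithm of the ratio has mean `a > 0` under the second one. -/
structure LRPair (q₀ q₁ : Measure ℝ≥0∞) (a : ℝ) : Prop where
  prob₀ : IsProbabilityMeasure q₀
  prob₁ : IsProbabilityMeasure q₁
  lintegral_eq : ∀ φ : ℝ≥0∞ → ℝ≥0∞, Measurable φ → ∫⁻ x, φ x ∂q₁ = ∫⁻ x, φ x * x ∂q₀
  rpow_lt_one : ∀ θ : ℝ, 0 < θ → θ < 1 → ∫⁻ x, x ^ θ ∂q₀ < 1
  integrable_log : Integrable (fun x => Real.log x.toReal) q₁
  integral_log : ∫ x, Real.log x.toReal ∂q₁ = a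
  ae_pos : ∀ᵐ x ∂q₁, x ≠ 0 ∧ x ≠ ⊤
  pos : 0 < a

section LikelihoodRatio

variable {T : Type*} [MeasurableSpace T] {f g : Measure T}
  [IsProbabilityMeasure f] [IsProbabilityMeasure g]

/-- The right side is the tangent at `1` of a concave function. -/
lemma rpow_le_affine {θ : ℝ} (h0 : 0 < θ) (h1 : θ < 1) (x : ℝ≥0∞) :
    x ^ θ ≤ ENNReal.ofReal θ * x + ENNReal.ofReal (1 - θ) := by
  rcases eq_or_ne x ⊤ with rfl | hx
  · simp [ENNReal.mul_top, h0]
  · lift x to NNReal using hx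
    have h := rpow_one_add_le_one_add_mul_self (s := (x : ℝ) - 1) (by linarith [x.2])
      h0.le h1.le
    rw [← ENNReal.coe_rpow_of_nonneg _ h0.le]
    rw [← ENNReal.ofReal_coe_nnreal, ← ENNReal.ofReal_coe_nnreal,
      ← ENNReal.ofReal_mul h0.le, ← ENNReal.ofReal_add (by positivity) (by linarith)]
    refine ENNReal.ofReal_le_ofReal ?_
    rw [NNReal.coe_rpow]
    calc (x : ℝ) ^ θ = (1 + ((x : ℝ) - 1)) ^ θ := by ring_nf
      _ ≤ _ := h
      _ = _ := by ring

lemma eq_one_of_rpow_eq_affine {θ : ℝ} (h0 : 0 < θ) (h1 : θ < 1) {x : ℝ≥0∞} (hx : x ≠ ⊤)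
    (h : x ^ θ = ENNReal.ofReal θ * x + ENNReal.ofReal (1 - θ)) : x = 1 := by
  lift x to NNReal using hx
  by_contra hne
  have hne' : (x : ℝ) - 1 ≠ 0 := by
    intro h'
    apply hne
    have : (x : ℝ) = 1 := by linarith
    exact_mod_cast this
  have h2 := rpow_one_add_lt_one_add_mul_self (s := (x : ℝ) - 1) (by linarith [x.2])
    hne' h0 h1
  have h3 := congrArg ENNReal.toReal h
  rw [ENNReal.toReal_add (by finiteness) (by finiteness), ENNReal.toReal_mul,
    ENNReal.toReal_ofReal h0.le, ENNReal.toReal_ofReal (by linarith), ← ENNReal.toReal_rpow,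
    ENNReal.coe_toReal] at h3
  have h4 : (1 + ((x : ℝ) - 1)) = x := by ring
  rw [h4] at h2
  nlinarith

/-- The tangent line at `1` integrates to `θ + (1 - θ) = 1`. Equality would force the density to be
`1` almost everywhere, hence `g = f` and divergence zero. -/
lemma lintegral_rpow_rnDeriv_lt_one (hac : g ≪ f) (hne : klDiv g f ≠ 0) {θ : ℝ} (h0 : 0 < θ)
    (h1 : θ < 1) : ∫⁻ x, g.rnDeriv f x ^ θ ∂f < 1 := by
  have hm : Measurable (g.rnDeriv f) := Measure.measurable_rnDeriv g f
  have hint : ∫⁻ x, (ENNReal.ofReal θ * g.rnDeriv f x + ENNReal.ofReal (1 - θ)) ∂f = 1 := by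
    rw [lintegral_add_right _ measurable_const, lintegral_const_mul _ hm,
      Measure.lintegral_rnDeriv hac, measure_univ, mul_one, lintegral_const, measure_univ, mul_one,
      ← ENNReal.ofReal_add h0.le (by linarith)]
    simp
  have hle : ∫⁻ x, g.rnDeriv f x ^ θ ∂f ≤ 1 := by
    rw [← hint]
    exact lintegral_mono fun x => rpow_le_affine h0 h1 _
  refine lt_of_le_of_ne hle fun heq => hne ?_
  have hae := ae_eq_of_ae_le_of_lintegral_le (μ := f)
    (f := fun x => g.rnDeriv f x ^ θ)
    (g := fun x => ENNReal.ofReal θ * g.rnDeriv f x + ENNReal.ofReal (1 - θ))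
    (ae_of_all _ fun x => rpow_le_affine h0 h1 _) (by simp [heq]) (by fun_prop)
    (by rw [heq, hint])
  have hone : g.rnDeriv f =ᵐ[f] 1 := by
    filter_upwards [hae, Measure.rnDeriv_lt_top g f] with x hx hx'
    exact eq_one_of_rpow_eq_affine h0 h1 hx'.ne hx
  have : g = f := by
    rw [← Measure.withDensity_rnDeriv_eq g f hac, withDensity_congr_ae hone, withDensity_one]
  rw [this, klDiv_self]

lemma lrPair_rnDeriv (hpos : klDiv g f ≠ 0) (hfin : klDiv g f ≠ ⊤) :
    LRPair (f.map (g.rnDeriv f)) (g.map (g.rnDeriv f)) (klDiv g f).toReal := by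
  have hm : Measurable (g.rnDeriv f) := Measure.measurable_rnDeriv g f
  obtain ⟨hac, hint⟩ := klDiv_ne_top_iff.1 hfin
  have hlog : Measurable fun x : ℝ≥0∞ => Real.log x.toReal := by fun_prop
  refine ⟨Measure.isProbabilityMeasure_map hm.aemeasurable,
    Measure.isProbabilityMeasure_map hm.aemeasurable, ?_, ?_, ?_, ?_, ?_,
    ENNReal.toReal_pos hpos hfin⟩
  · intro φ hφ
    rw [lintegral_map hφ hm, lintegral_map (by fun_prop) hm]
    rw [← lintegral_rnDeriv_mul hac (f := fun x => φ (g.rnDeriv f x))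
      (hφ.comp hm).aemeasurable]
    exact lintegral_congr fun x => mul_comm _ _
  · intro θ h0 h1
    rw [lintegral_map (by fun_prop) hm]
    exact lintegral_rpow_rnDeriv_lt_one hac hpos h0 h1
  · rw [integrable_map_measure hlog.aestronglyMeasurable hm.aemeasurable]
    exact hint
  · rw [integral_map hm.aemeasurable hlog.aestronglyMeasurable,
      toReal_klDiv_of_measure_eq hac (by simp)]
    rfl
  · rw [ae_map_iff hm.aemeasurable]
    · filter_upwards [Measure.rnDeriv_pos hac, hac.ae_le (Measure.rnDeriv_lt_top g f)]
        with x h1 h2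
      exact ⟨h1.ne', h2.ne⟩
    · exact (measurableSet_singleton 0).compl.inter (measurableSet_singleton ⊤).compl

end LikelihoodRatio

/-! ### Independence over disjoint sets of sensors and times -/

/-- Independent random variables `Y i t`, where `Y i t` has law `q i`. -/
structure IIDModel {ι Ω : Type*} [MeasurableSpace Ω] (Y : ι → ℕ → Ω → ℝ≥0∞)
    (q : ι → Measure ℝ≥0∞) (P : Measure Ω) : Prop where
  measurable : ∀ i t, Measurable (Y i t)
  law : ∀ i t, P.map (Y i t) = q i
  indep : iIndepFun (fun p : ι × ℕ => Y p.1 p.2) P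

/-- The `σ`-algebra generated by the variables with index in `S`. -/
@[reducible]
def sigmaGen {ι Ω : Type*} (Y : ι → ℕ → Ω → ℝ≥0∞) (S : Set (ι × ℕ)) : MeasurableSpace Ω :=
  ⨆ p ∈ S, MeasurableSpace.comap (Y p.1 p.2) inferInstance

lemma measurable_sigmaGen {ι Ω : Type*} {Y : ι → ℕ → Ω → ℝ≥0∞} {S : Set (ι × ℕ)} {i : ι} {t : ℕ}
    (h : (i, t) ∈ S) : Measurable[sigmaGen Y S] (Y i t) :=
  (comap_measurable (Y i t)).mono
    (le_iSup₂_of_le (f := fun (p : ι × ℕ) (_ : p ∈ S) =>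
      MeasurableSpace.comap (Y p.1 p.2) inferInstance) (i, t) h le_rfl) le_rfl

namespace IIDModel

variable {ι Ω : Type*} [MeasurableSpace Ω] {Y : ι → ℕ → Ω → ℝ≥0∞}
  {q : ι → Measure ℝ≥0∞} {P : Measure Ω}

lemma isProbabilityMeasure (hM : IIDModel Y q P) : IsProbabilityMeasure P :=
  hM.indep.isProbabilityMeasure

lemma sigmaGen_le (hM : IIDModel Y q P) (S : Set (ι × ℕ)) : sigmaGen Y S ≤ ‹MeasurableSpace Ω› :=
  iSup₂_le fun p _ => (hM.measurable p.1 p.2).comap_le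

lemma indep_sigmaGen (hM : IIDModel Y q P) {S T : Set (ι × ℕ)} (h : Disjoint S T) :
    Indep (sigmaGen Y S) (sigmaGen Y T) P :=
  indep_iSup_of_disjoint (m := fun p : ι × ℕ => MeasurableSpace.comap (Y p.1 p.2) inferInstance)
    (fun p => (hM.measurable p.1 p.2).comap_le) ((iIndepFun_iff_iIndep _ _ _).1 hM.indep) h

lemma indepFun_of_disjoint (hM : IIDModel Y q P) {S T : Set (ι × ℕ)} (h : Disjoint S T)
    {β γ : Type*} [MeasurableSpace β] [MeasurableSpace γ] {U : Ω → β} {V : Ω → γ}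
    (hU : Measurable[sigmaGen Y S] U) (hV : Measurable[sigmaGen Y T] V) : IndepFun U V P := by
  rw [IndepFun_iff_Indep]
  exact indep_of_indep_of_le (hM.indep_sigmaGen h) hU.comap_le hV.comap_le

/-- Used for different sensors over the same times as well as for disjoint blocks of time. -/
lemma measure_biInter {κ : Type*} (hM : IIDModel Y q P) (A : Finset κ) {S : κ → Set (ι × ℕ)}
    (hS : ∀ k l, k ≠ l → Disjoint (S k) (S l)) {E : κ → Set Ω}
    (hE : ∀ k, MeasurableSet[sigmaGen Y (S k)] (E k)) :
    P (⋂ k ∈ A, E k) = ∏ k ∈ A, P (E k) := by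
  classical
  have := hM.isProbabilityMeasure
  induction A using Finset.induction_on with
  | empty => simp
  | insert k A hk ih =>
    rw [Finset.prod_insert hk, ← ih, Finset.set_biInter_insert]
    have hd : Disjoint (S k) (⋃ l ∈ A, S l) := by
      rw [Set.disjoint_iUnion₂_right]
      exact fun l hl => hS k l (by rintro rfl; exact hk hl)
    refine (Indep_iff _ _ P).1 (hM.indep_sigmaGen hd) _ _ (hE k) ?_
    refine Finset.measurableSet_biInter _ fun l hl => ?_
    refine (iSup₂_mono' fun p hp => ⟨p, ?_, le_rfl⟩ : sigmaGen Y (S l) ≤ _) _ (hE l)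
    exact Set.mem_biUnion (Finset.mem_coe.2 hl) hp

end IIDModel

/-! ### Blocks of observations and the change of measure -/

/-- The event that the exponential CUSUM statistic of `i` at time `t` is above `exp b`. -/
def above {ι Ω : Type*} (Y : ι → ℕ → Ω → ℝ≥0∞) (b : ℝ) (i : ι) (t : ℕ) : Set Ω :=
  {ω | ENNReal.ofReal (Real.exp b) < expCusum (fun s => Y i s ω) t}

/-- The event that the product of the `n` likelihood ratios of `i` from time `m` on is
above `exp b`. -/
def blockAbove {ι Ω : Type*} (Y : ι → ℕ → Ω → ℝ≥0∞) (b : ℝ) (i : ι) (m n : ℕ) : Set Ω :=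
  {ω | ENNReal.ofReal (Real.exp b) < ∏ s ∈ Finset.range n, Y i (m + s) ω}

lemma blockAbove_subset_above {ι Ω : Type*} (Y : ι → ℕ → Ω → ℝ≥0∞) {b : ℝ} (hb : 0 ≤ b) (i : ι)
    (m n : ℕ) : blockAbove Y b i m n ⊆ above Y b i (m + n) := by
  intro ω hω
  have h := lt_of_lt_of_le hω (prod_le_max_one_expCusum (fun s => Y i s ω) m n)
  rcases lt_max_iff.1 h with h | h
  · exact absurd h (not_lt.2 (by simpa using hb))
  · exact h

/-- The law of the product of `n` independent variables with law `q`. -/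
noncomputable def prodLaw (q : Measure ℝ≥0∞) : ℕ → Measure ℝ≥0∞
  | 0 => Measure.dirac 1
  | n + 1 => ((prodLaw q n).prod q).map fun p => p.1 * p.2

lemma isProbabilityMeasure_prodLaw (q : Measure ℝ≥0∞) [IsProbabilityMeasure q] (n : ℕ) :
    IsProbabilityMeasure (prodLaw q n) := by
  induction n with
  | zero => exact Measure.dirac.isProbabilityMeasure
  | succ n ih => exact Measure.isProbabilityMeasure_map (by fun_prop)

/-- A product of independent likelihood ratios is again a likelihood ratio: the weight splits into
one factor per observation. -/
lemma LRPair.lintegral_prodLaw {q₀ q₁ : Measure ℝ≥0∞} {a : ℝ} (h : LRPair q₀ q₁ a) (n : ℕ)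
    {φ : ℝ≥0∞ → ℝ≥0∞} (hφ : Measurable φ) :
    ∫⁻ x, φ x ∂prodLaw q₁ n = ∫⁻ x, φ x * x ∂prodLaw q₀ n := by
  have := h.prob₀
  have := h.prob₁
  induction n generalizing φ with
  | zero => simp [prodLaw, lintegral_dirac]
  | succ n ih =>
    have := isProbabilityMeasure_prodLaw q₀ n
    have := isProbabilityMeasure_prodLaw q₁ n
    simp only [prodLaw]
    rw [lintegral_map hφ (by fun_prop), lintegral_map (by fun_prop) (by fun_prop),
      lintegral_prod _ (by fun_prop), lintegral_prod _ (by fun_prop)]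
    have h1 : ∀ x, ∫⁻ y, φ (x * y) ∂q₁ = ∫⁻ y, φ (x * y) * y ∂q₀ := fun x =>
      h.lintegral_eq (fun y => φ (x * y)) (by fun_prop)
    simp_rw [h1]
    rw [ih (Measurable.lintegral_prod_right' (f := fun p : ℝ≥0∞ × ℝ≥0∞ => φ (p.1 * p.2) * p.2)
      (by fun_prop))]
    refine lintegral_congr fun x => ?_
    rw [← lintegral_mul_const _ (by fun_prop)]
    refine lintegral_congr fun y => ?_
    ring

/-- Change of measure, with the density `x` bounded by `c` on the interval; this is why an upper
cutoff is needed. -/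
lemma LRPair.prodLaw_gt_ge {q₀ q₁ : Measure ℝ≥0∞} {a : ℝ} (h : LRPair q₀ q₁ a) (n : ℕ)
    (b c : ℝ≥0∞) :
    prodLaw q₁ n (Set.Ioc b c) ≤ prodLaw q₀ n (Set.Ioi b) * c := by
  rw [← lintegral_indicator_one measurableSet_Ioc,
    h.lintegral_prodLaw n (measurable_one.indicator measurableSet_Ioc)]
  calc ∫⁻ x, (Set.Ioc b c).indicator 1 x * x ∂prodLaw q₀ n
      ≤ ∫⁻ x, (Set.Ioi b).indicator (fun _ => c) x ∂prodLaw q₀ n := by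
        refine lintegral_mono fun x => ?_
        by_cases hx : x ∈ Set.Ioc b c
        · simp [Set.indicator, hx, (Set.mem_Ioc.1 hx).1, (Set.mem_Ioc.1 hx).2]
        · simp [Set.indicator_of_notMem hx]
    _ = _ := by
        rw [lintegral_indicator_const measurableSet_Ioi, mul_comm]

section Generated

variable {ι Ω : Type*} {Y : ι → ℕ → Ω → ℝ≥0∞}

lemma measurable_expCusum_of_forall_mem {S : Set (ι × ℕ)} {i : ι} {t : ℕ}
    (hS : ∀ s < t, (i, s) ∈ S) :
    Measurable[sigmaGen Y S] fun ω => expCusum (fun s => Y i s ω) t := by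
  have h : ∀ s < t, Measurable[sigmaGen Y S] (Y i s) := fun s hs => measurable_sigmaGen (hS s hs)
  exact measurable_expCusum h

lemma measurable_expCusum_sigmaGen (i : ι) (t : ℕ) :
    Measurable[sigmaGen Y ({i} ×ˢ Set.Iio t)] fun ω => expCusum (fun s => Y i s ω) t :=
  measurable_expCusum_of_forall_mem (by simp)

lemma measurable_prod_sigmaGen (i : ι) (m n : ℕ) :
    Measurable[sigmaGen Y ({i} ×ˢ Set.Ico m (m + n))]
      fun ω => ∏ s ∈ Finset.range n, Y i (m + s) ω :=
  @Finset.measurable_fun_prod _ _ _ _ _ _ (sigmaGen Y ({i} ×ˢ Set.Ico m (m + n)))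
    (fun s => Y i (m + s)) (Finset.range n)
    fun s hs => measurable_sigmaGen (by simpa using hs)

lemma measurableSet_above_sigmaGen (b : ℝ) (i : ι) (t : ℕ) :
    MeasurableSet[sigmaGen Y ({i} ×ˢ Set.Iio t)] (above Y b i t) :=
  (measurable_expCusum_sigmaGen i t) measurableSet_Ioi

lemma measurableSet_blockAbove_sigmaGen (b : ℝ) (i : ι) (m n : ℕ) :
    MeasurableSet[sigmaGen Y ({i} ×ˢ Set.Ico m (m + n))] (blockAbove Y b i m n) :=
  measurable_prod_sigmaGen i m n measurableSet_Ioi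

end Generated

/-! ### Exponential tails before the change -/

namespace IIDModel

variable {ι Ω : Type*} [MeasurableSpace Ω] {Y : ι → ℕ → Ω → ℝ≥0∞}
  {q q' : ι → Measure ℝ≥0∞} {P : Measure Ω}

lemma map_prod (hM : IIDModel Y q P) (i : ι) (m n : ℕ) :
    P.map (fun ω => ∏ s ∈ Finset.range n, Y i (m + s) ω) = prodLaw (q i) n := by
  have := hM.isProbabilityMeasure
  induction n with
  | zero => simp [prodLaw, Measure.map_const]
  | succ n ih =>
    have hp : Measurable fun ω => ∏ s ∈ Finset.range n, Y i (m + s) ω :=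
      (measurable_prod_sigmaGen i m n).mono (hM.sigmaGen_le _) le_rfl
    have hi : IndepFun (fun ω => ∏ s ∈ Finset.range n, Y i (m + s) ω) (Y i (m + n)) P :=
      hM.indepFun_of_disjoint (T := {(i, m + n)}) (by simp) (measurable_prod_sigmaGen i m n)
        (measurable_sigmaGen (by simp))
    simp_rw [Finset.prod_range_succ, prodLaw]
    rw [← ih, ← hM.law i (m + n),
      ← (indepFun_iff_map_prod_eq_prod_map_map hp.aemeasurable
        (hM.measurable _ _).aemeasurable).1 hi,
      Measure.map_map (by fun_prop) (hp.prodMk (hM.measurable _ _))]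
    rfl

lemma measure_blockAbove (hM : IIDModel Y q P) (b : ℝ) (i : ι) (m n : ℕ) :
    P (blockAbove Y b i m n) = prodLaw (q i) n (Set.Ioi (ENNReal.ofReal (Real.exp b))) := by
  rw [← hM.map_prod i m n, Measure.map_apply
    ((measurable_prod_sigmaGen i m n).mono (hM.sigmaGen_le _) le_rfl) measurableSet_Ioi]
  rfl

/-- Since `max 1 V ^ θ ≤ 1 + V ^ θ` and the new factor is independent of the past, the moments
satisfy `m (t + 1) ≤ (1 + m t) * r` with `r < 1`. The stated bound is the fixed point of `m ↦ 1 + m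
* r`, so it is preserved. -/
lemma lintegral_rpow_expCusum_le (hM : IIDModel Y q P) (i : ι) {θ : ℝ} (h0 : 0 < θ)
    (hr : ∫⁻ x, x ^ θ ∂q i < 1) (t : ℕ) :
    ∫⁻ ω, expCusum (fun s => Y i s ω) t ^ θ ∂P ≤ (1 - ∫⁻ x, x ^ θ ∂q i)⁻¹ := by
  have := hM.isProbabilityMeasure
  set r := ∫⁻ x, x ^ θ ∂q i with hrdef
  induction t with
  | zero => simp [expCusum]
  | succ t ih =>
    have hV : Measurable fun ω => expCusum (fun s => Y i s ω) t :=
      (measurable_expCusum_sigmaGen i t).mono (hM.sigmaGen_le _) le_rfl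
    have hi : IndepFun (fun ω => expCusum (fun s => Y i s ω) t) (Y i t) P :=
      hM.indepFun_of_disjoint (T := {(i, t)}) (by simp) (measurable_expCusum_sigmaGen i t)
        (measurable_sigmaGen (by simp))
    have hi' : IndepFun (fun ω => 1 + expCusum (fun s => Y i s ω) t ^ θ)
        (fun ω => Y i t ω ^ θ) P :=
      hi.comp (φ := fun x : ℝ≥0∞ => 1 + x ^ θ) (ψ := fun x : ℝ≥0∞ => x ^ θ)
        (by fun_prop) (by fun_prop)
    have hY : ∫⁻ ω, Y i t ω ^ θ ∂P = r := by
      rw [hrdef, ← hM.law i t, lintegral_map (by fun_prop) (hM.measurable i t)]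
    calc ∫⁻ ω, expCusum (fun s => Y i s ω) (t + 1) ^ θ ∂P
        ≤ ∫⁻ ω, (1 + expCusum (fun s => Y i s ω) t ^ θ) * Y i t ω ^ θ ∂P := by
          refine lintegral_mono fun ω => ?_
          simp only [expCusum]
          rw [ENNReal.mul_rpow_of_nonneg _ _ h0.le]
          gcongr
          rcases max_cases 1 (expCusum (fun s => Y i s ω) t) with h | h <;> rw [h.1] <;> simp
      _ = (1 + ∫⁻ ω, expCusum (fun s => Y i s ω) t ^ θ ∂P) * r := by
          have h2 := lintegral_mul_eq_lintegral_mul_lintegral_of_indepFun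
            (hV.pow_const θ |>.const_add 1) ((hM.measurable i t).pow_const θ) hi'
          simp only [Pi.mul_apply] at h2
          rw [h2, hY, lintegral_add_left measurable_const]
          simp
      _ ≤ (1 + (1 - r)⁻¹) * r := by gcongr
      _ ≤ 1 + (1 - r)⁻¹ * r := by
          rw [add_mul, one_mul]
          gcongr
      _ = (1 - r)⁻¹ * (1 - r) + (1 - r)⁻¹ * r := by
          rw [ENNReal.inv_mul_cancel (tsub_pos_of_lt hr).ne' (by finiteness)]
      _ = (1 - r)⁻¹ := by
          rw [← mul_add, tsub_add_cancel_of_le hr.le, mul_one]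

/-- Markov's inequality for the `θ`-th power. An exponent `θ` below the critical value `1` is
enough, because only logarithmic asymptotics are needed. -/
lemma exists_tail_bound [Finite ι] {a : ι → ℝ} (hM : IIDModel Y q P)
    (hL : ∀ i, LRPair (q i) (q' i) (a i)) {θ : ℝ} (h0 : 0 < θ) (h1 : θ < 1) :
    ∃ K : ℝ, 1 ≤ K ∧ ∀ i t b, P (above Y b i t) ≤ ENNReal.ofReal (K * Real.exp (-(θ * b))) := by
  have := Fintype.ofFinite ι
  set C : ι → ℝ := fun i => ((1 - ∫⁻ x, x ^ θ ∂q i)⁻¹).toReal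
  have hC : ∀ i, 0 ≤ C i := fun i => ENNReal.toReal_nonneg
  refine ⟨1 + ∑ i, C i, by linarith [Finset.sum_nonneg fun i (_ : i ∈ Finset.univ) => hC i],
    fun i t b => ?_⟩
  have hr := (hL i).rpow_lt_one θ h0 h1
  have hfin : (1 - ∫⁻ x, x ^ θ ∂q i)⁻¹ ≠ ⊤ := ENNReal.inv_ne_top.2 (tsub_pos_of_lt hr).ne'
  have hV : Measurable fun ω => expCusum (fun s => Y i s ω) t :=
    (measurable_expCusum_sigmaGen i t).mono (hM.sigmaGen_le _) le_rfl
  have hmk := mul_meas_ge_le_lintegral (μ := P) (hV.pow_const θ)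
    (ENNReal.ofReal (Real.exp (θ * b)))
  have hle := hmk.trans (hM.lintegral_rpow_expCusum_le i h0 hr t)
  have hsub : above Y b i t ⊆
      {ω | ENNReal.ofReal (Real.exp (θ * b)) ≤ expCusum (fun s => Y i s ω) t ^ θ} := by
    intro ω hω
    have : ENNReal.ofReal (Real.exp (θ * b)) = ENNReal.ofReal (Real.exp b) ^ θ := by
      rw [ENNReal.ofReal_rpow_of_pos (Real.exp_pos _), ← Real.exp_mul, mul_comm]
    rw [Set.mem_ofPred_eq, this]
    exact ENNReal.rpow_le_rpow (le_of_lt hω) h0.le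
  calc P (above Y b i t) ≤ P {ω | ENNReal.ofReal (Real.exp (θ * b)) ≤
        expCusum (fun s => Y i s ω) t ^ θ} := measure_mono hsub
    _ ≤ (1 - ∫⁻ x, x ^ θ ∂q i)⁻¹ / ENNReal.ofReal (Real.exp (θ * b)) := by
        rw [ENNReal.le_div_iff_mul_le (Or.inl (by simp [Real.exp_pos])) (Or.inl (by simp)),
          mul_comm]
        exact hle
    _ = ENNReal.ofReal (C i * Real.exp (-(θ * b))) := by
        rw [ENNReal.ofReal_mul (hC i), ENNReal.ofReal_toReal hfin, Real.exp_neg,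
          ENNReal.ofReal_inv_of_pos (Real.exp_pos _), div_eq_mul_inv]
    _ ≤ _ := by
        refine ENNReal.ofReal_le_ofReal (mul_le_mul_of_nonneg_right ?_ (Real.exp_pos _).le)
        linarith [Finset.single_le_sum (fun i _ => hC i) (Finset.mem_univ i)]

end IIDModel

/-! ### Linear growth after the change -/

lemma prod_eq_ofReal_exp_sum_log {y : ℕ → ℝ≥0∞} (hy : ∀ s, y s ≠ 0 ∧ y s ≠ ⊤) (n : ℕ) :
    ∏ s ∈ Finset.range n, y s =
      ENNReal.ofReal (Real.exp (∑ s ∈ Finset.range n, Real.log (y s).toReal)) := by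
  rw [Real.exp_sum, ENNReal.ofReal_prod_of_nonneg fun _ _ => (Real.exp_pos _).le]
  refine Finset.prod_congr rfl fun s _ => ?_
  rw [Real.exp_log (ENNReal.toReal_pos (hy s).1 (hy s).2), ENNReal.ofReal_toReal (hy s).2]

/-- If no partial sum of the logarithms is below `-C`, the CUSUM statistic exceeds the partial sum
by at most `C`. -/
lemma max_one_expCusum_le {y : ℕ → ℝ≥0∞} (hy : ∀ s, y s ≠ 0 ∧ y s ≠ ⊤) {C : ℝ}
    (hC : ∀ n, -C ≤ ∑ s ∈ Finset.range n, Real.log (y s).toReal) (n : ℕ) :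
    max 1 (expCusum y n) ≤
      ENNReal.ofReal (Real.exp (∑ s ∈ Finset.range n, Real.log (y s).toReal + C)) := by
  have h1 : ∀ n, (1 : ℝ≥0∞) ≤
      ENNReal.ofReal (Real.exp (∑ s ∈ Finset.range n, Real.log (y s).toReal + C)) := fun n => by
    rw [← ENNReal.ofReal_one]
    exact ENNReal.ofReal_le_ofReal (Real.one_le_exp (by linarith [hC n]))
  induction n with
  | zero => exact max_le (h1 0) (h1 0)
  | succ n ih =>
    refine max_le (h1 _) ?_
    have hyn : y n = ENNReal.ofReal (Real.exp (Real.log (y n).toReal)) := by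
      rw [Real.exp_log (ENNReal.toReal_pos (hy n).1 (hy n).2), ENNReal.ofReal_toReal (hy n).2]
    calc max 1 (expCusum y n) * y n
        ≤ ENNReal.ofReal (Real.exp (∑ s ∈ Finset.range n, Real.log (y s).toReal + C)) * y n := by
          gcongr
      _ = ENNReal.ofReal (Real.exp (∑ s ∈ Finset.range n, Real.log (y s).toReal + C)) *
            ENNReal.ofReal (Real.exp (Real.log (y n).toReal)) := by rw [← hyn]
      _ = _ := by
          rw [← ENNReal.ofReal_mul (Real.exp_pos _).le, ← Real.exp_add, Finset.sum_range_succ]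
          ring_nf

/-- If the averages of `log y` converge to `a > 0`, the logarithm of the CUSUM statistic grows at
most linearly, with any rate larger than `a`. -/
lemma exists_expCusum_le {y : ℕ → ℝ≥0∞} (hy : ∀ s, y s ≠ 0 ∧ y s ≠ ⊤) {a a' : ℝ} (ha : 0 < a)
    (ha' : a < a')
    (h : Tendsto (fun n : ℕ => (∑ s ∈ Finset.range n, Real.log (y s).toReal) / n) atTop (𝓝 a)) :
    ∃ C : ℝ, ∀ n : ℕ, expCusum y n ≤ ENNReal.ofReal (Real.exp (a' * n + C)) := by
  set S : ℕ → ℝ := fun n => ∑ s ∈ Finset.range n, Real.log (y s).toReal with hS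
  have hmul : ∀ n : ℕ, (n : ℝ) * (S n / n) = S n := by
    intro n
    rcases Nat.eq_zero_or_pos n with rfl | hn
    · simp [hS]
    · field_simp
  have h1 : Tendsto S atTop atTop := by
    have := tendsto_natCast_atTop_atTop (R := ℝ) |>.atTop_mul_pos ha h
    exact this.congr hmul
  have h2 : Tendsto (fun n : ℕ => a' * n - S n) atTop atTop := by
    have := tendsto_natCast_atTop_atTop (R := ℝ) |>.atTop_mul_pos (sub_pos.2 ha')
      (tendsto_const_nhds.sub h)
    refine this.congr fun n => ?_
    rw [mul_sub, hmul, mul_comm]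
  -- `c₁` controls the excess of the CUSUM over the random walk `S`, and `c₂` the excess of `S` over
  -- the line of slope `a'`.
  obtain ⟨c₁, hc₁⟩ := bddBelow_range_of_tendsto_atTop_atTop h1
  obtain ⟨c₂, hc₂⟩ := bddBelow_range_of_tendsto_atTop_atTop h2
  refine ⟨-c₁ - c₂, fun n => ?_⟩
  have h3 := max_one_expCusum_le hy (C := -c₁)
    (fun n => by simpa using hc₁ (Set.mem_range_self n)) n
  refine (le_max_right _ _).trans (h3.trans (ENNReal.ofReal_le_ofReal (Real.exp_le_exp.2 ?_)))
  have h4 := hc₂ (Set.mem_range_self n)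
  simp only [hS] at h4
  linarith

namespace IIDModel

variable {ι Ω : Type*} [MeasurableSpace Ω] {Y : ι → ℕ → Ω → ℝ≥0∞}
  {q q' : ι → Measure ℝ≥0∞} {P : Measure Ω} {a : ι → ℝ}

lemma ae_ne_zero_ne_top (hM : IIDModel Y q' P) (hL : ∀ i, LRPair (q i) (q' i) (a i)) (i : ι) :
    ∀ᵐ ω ∂P, ∀ s, Y i s ω ≠ 0 ∧ Y i s ω ≠ ⊤ := by
  rw [ae_all_iff]
  intro s
  have h := (hL i).ae_pos
  rw [← hM.law i s] at h
  exact ae_of_ae_map (hM.measurable i s).aemeasurable h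

lemma ae_tendsto_average_log (hM : IIDModel Y q' P) (hL : ∀ i, LRPair (q i) (q' i) (a i)) (i : ι) :
    ∀ᵐ ω ∂P, Tendsto (fun n : ℕ => (∑ s ∈ Finset.range n, Real.log (Y i s ω).toReal) / n)
      atTop (𝓝 (a i)) := by
  have hlog : Measurable fun x : ℝ≥0∞ => Real.log x.toReal := by fun_prop
  have hm := hM.measurable
  have h := strong_law_ae_real (μ := P) (fun s ω => Real.log (Y i s ω).toReal) ?_ ?_ ?_
  · have hmean : ∫ ω, Real.log (Y i 0 ω).toReal ∂P = a i := by
      rw [← (hL i).integral_log, ← hM.law i 0,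
        integral_map (hm i 0).aemeasurable hlog.aestronglyMeasurable]
    rwa [hmean] at h
  · have := (hL i).integrable_log
    rw [← hM.law i 0, integrable_map_measure hlog.aestronglyMeasurable (hm i 0).aemeasurable]
      at this
    exact this
  · intro s t hst
    exact (hM.indep.indepFun (i := (i, s)) (j := (i, t)) (by simpa using hst)).comp hlog hlog
  · intro s
    refine IdentDistrib.comp (u := fun x : ℝ≥0∞ => Real.log x.toReal) ?_ hlog
    exact ⟨(hm i s).aemeasurable, (hm i 0).aemeasurable, by rw [hM.law, hM.law]⟩

lemma tendsto_prodLaw (hM : IIDModel Y q' P) (hL : ∀ i, LRPair (q i) (q' i) (a i)) (i : ι) {d : ℝ}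
    (hd : 1 < d) :
    Tendsto (fun n : ℕ => prodLaw (q' i) n (Set.Ioc (ENNReal.ofReal (Real.exp (a i * n / d)))
      (ENNReal.ofReal (Real.exp (d * a i * n))))) atTop (𝓝 1) := by
  have := hM.isProbabilityMeasure
  have hm : ∀ n, Measurable fun ω => ∏ s ∈ Finset.range n, Y i s ω := fun n =>
    Finset.measurable_fun_prod _ fun s _ => hM.measurable i s
  have hmap : ∀ n, prodLaw (q' i) n = P.map fun ω => ∏ s ∈ Finset.range n, Y i s ω := fun n => by
    simpa using (hM.map_prod i 0 n).symm
  simp_rw [hmap, fun n => Measure.map_apply (μ := P) (hm n)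
    (measurableSet_Ioc (a := ENNReal.ofReal (Real.exp (a i * n / d)))
      (b := ENNReal.ofReal (Real.exp (d * a i * n))))]
  rw [← measure_univ (μ := P)]
  refine tendsto_measure_of_ae_tendsto_indicator_of_isFiniteMeasure _ MeasurableSet.univ
    (fun n => hm n measurableSet_Ioc) ?_
  filter_upwards [hM.ae_ne_zero_ne_top hL i, hM.ae_tendsto_average_log hL i] with ω h1 h2
  have ha := (hL i).pos
  have h3 := h2.eventually_const_lt (show a i / d < a i from div_lt_self ha hd)
  have h4 := h2.eventually_lt_const (show a i < d * a i by nlinarith)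
  filter_upwards [h3, h4, eventually_gt_atTop 0] with n h5 h6 h7
  have hn : (0 : ℝ) < n := by exact_mod_cast h7
  simp only [Set.mem_univ, iff_true, Set.mem_preimage]
  rw [prod_eq_ofReal_exp_sum_log h1, Set.mem_Ioc]
  rw [lt_div_iff₀ hn] at h5
  rw [div_lt_iff₀ hn] at h6
  constructor
  · rw [ENNReal.ofReal_lt_ofReal_iff (Real.exp_pos _), Real.exp_lt_exp]
    calc a i * n / d = a i / d * n := by ring
      _ < _ := h5
  · exact ENNReal.ofReal_le_ofReal (Real.exp_le_exp.2 h6.le)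

lemma measurable_expCusum' (hM : IIDModel Y q P) (i : ι) (t : ℕ) :
    Measurable fun ω => expCusum (fun s => Y i s ω) t :=
  (measurable_expCusum_sigmaGen i t).mono (hM.sigmaGen_le _) le_rfl

/-- Almost surely the log-statistic stays below a line of slope `a'` with some random intercept, and
a deterministic `x` eventually exceeds that intercept. -/
lemma tendsto_measure_exists_expCusum_gt (hM : IIDModel Y q' P)
    (hL : ∀ i, LRPair (q i) (q' i) (a i)) (i : ι) {a' : ℝ} (ha' : a i < a') :
    Tendsto (fun x : ℝ => P (⋃ t : ℕ, above Y (a' * t + x) i t)) atTop (𝓝 0) := by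
  have := hM.isProbabilityMeasure
  rw [← measure_empty (μ := P)]
  refine tendsto_measure_of_ae_tendsto_indicator_of_isFiniteMeasure _ MeasurableSet.empty
    (fun x => MeasurableSet.iUnion fun t => hM.measurable_expCusum' i t measurableSet_Ioi) ?_
  filter_upwards [hM.ae_ne_zero_ne_top hL i, hM.ae_tendsto_average_log hL i] with ω h1 h2
  obtain ⟨C, hC⟩ := exists_expCusum_le h1 (hL i).pos ha' h2
  filter_upwards [eventually_ge_atTop C] with x hx
  simp only [Set.mem_empty_iff_false, iff_false, Set.mem_iUnion, not_exists]
  intro t ht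
  refine absurd ht (not_lt.2 ((hC t).trans ?_))
  exact ENNReal.ofReal_le_ofReal (Real.exp_le_exp.2 (by linarith))

/-- Before time `c * h`, where `c < 1`, it is unlikely that a CUSUM statistic with drift `a i` is
above `a i * h`. -/
lemma tendsto_measure_early [Finite ι] (hM : IIDModel Y q' P)
    (hL : ∀ i, LRPair (q i) (q' i) (a i)) {c : ℝ} (h0 : 0 < c) (h1 : c < 1) :
    Tendsto (fun h : ℝ => P {ω | ∃ i, ∃ t : ℕ, (t : ℝ) ≤ c * h ∧ ω ∈ above Y (a i * h) i t})
      atTop (𝓝 0) := by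
  have := Fintype.ofFinite ι
  -- The line of this slope and intercept reaches exactly `a i * h` at time `c * h`, so an earlier
  -- crossing of `a i * h` lies above the line.
  have hlim : Tendsto (fun h : ℝ => ∑ i, P (⋃ t : ℕ,
      above Y ((a i + a i * (1 - c) / (2 * c)) * t + a i * (1 - c) / 2 * h) i t))
      atTop (𝓝 0) := by
    have hz : (0 : ℝ≥0∞) = ∑ _i : ι, 0 := Finset.sum_const_zero.symm
    conv => arg 3; rw [hz]
    refine tendsto_finsetSum _ fun i _ => ?_
    have ha := (hL i).pos
    have hc : 0 < 1 - c := by linarith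
    have hpos : 0 < a i * (1 - c) / (2 * c) := by positivity
    exact (hM.tendsto_measure_exists_expCusum_gt hL i (lt_add_of_pos_right _ hpos)).comp
      (tendsto_id.const_mul_atTop (by positivity))
  refine tendsto_of_tendsto_of_tendsto_of_le_of_le tendsto_const_nhds hlim
    (fun _ => zero_le) fun h => ?_
  refine (measure_mono ?_).trans (measure_iUnion_fintype_le P _)
  rintro ω ⟨i, t, ht, hω⟩
  refine Set.mem_iUnion.2 ⟨i, Set.mem_iUnion.2 ⟨t, ?_⟩⟩
  refine lt_of_le_of_lt ?_ (show ENNReal.ofReal (Real.exp (a i * h)) < _ from hω)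
  refine ENNReal.ofReal_le_ofReal (Real.exp_le_exp.2 ?_)
  have ha := (hL i).pos
  have hc : 0 < 1 - c := by linarith
  have hpos : 0 < a i * (1 - c) / (2 * c) := by positivity
  calc (a i + a i * (1 - c) / (2 * c)) * t + a i * (1 - c) / 2 * h
      ≤ (a i + a i * (1 - c) / (2 * c)) * (c * h) + a i * (1 - c) / 2 * h := by gcongr
    _ = a i * h := by
        field_simp
        ring

end IIDModel

/-! ### Comparison of the stopping times -/

lemma mem_of_iInf_eq_coe {s : Set ℕ} {m : ℕ} (h : ⨅ t ∈ s, (t : ℕ∞) = m) : m ∈ s := by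
  obtain ⟨t, hts, htm⟩ : ∃ t ∈ s, t ≤ m := by
    by_contra! hcon
    have : ((m + 1 : ℕ) : ℕ∞) ≤ ⨅ t ∈ s, (t : ℕ∞) :=
      le_iInf₂ fun t ht => by exact_mod_cast hcon t ht
    rw [h] at this
    have h2 : m + 1 ≤ m := by exact_mod_cast this
    omega
  have hmt : (m : ℕ∞) ≤ t := h ▸ iInf₂_le t hts
  have : m = t := le_antisymm (by exact_mod_cast hmt) htm
  exact this ▸ hts

lemma le_toENNReal_iInf {s : Set ℕ} {x : ℝ≥0∞} (h : ∀ t ∈ s, x ≤ (t : ℝ≥0∞)) :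
    x ≤ ((⨅ t ∈ s, (t : ℕ∞) : ℕ∞) : ℝ≥0∞) := by
  rcases eq_or_ne (⨅ t ∈ s, (t : ℕ∞)) ⊤ with htop | htop
  · rw [htop]
    simp
  · obtain ⟨m, hm⟩ := ENat.ne_top_iff_exists.1 htop
    rw [← hm]
    simpa using h m (mem_of_iInf_eq_coe hm.symm)

lemma sigmaGen_mono {ι Ω : Type*} {Y : ι → ℕ → Ω → ℝ≥0∞} {S T : Set (ι × ℕ)} (h : S ⊆ T) :
    sigmaGen Y S ≤ sigmaGen Y T :=
  biSup_mono h

section Times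

variable {ι Ω : Type*} (Y : ι → ℕ → Ω → ℝ≥0∞)

/-- The first time at which all statistics in `A` are above their thresholds. -/
noncomputable def hitTime (A : Finset ι) (b : ι → ℝ) (ω : Ω) : ℕ∞ :=
  ⨅ t ∈ {t : ℕ | 1 ≤ t ∧ ∀ i ∈ A, ω ∈ above Y (b i) i t}, (t : ℕ∞)

/-- The first time at which `M` statistics are simultaneously above their thresholds. -/
noncomputable def voteTime (M : ℕ) (b : ι → ℝ) (ω : Ω) : ℕ∞ :=
  ⨅ t ∈ {t : ℕ | 1 ≤ t ∧ M ≤ Set.ncard {i | ω ∈ above Y (b i) i t}}, (t : ℕ∞)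

/-- The first time by which `M` statistics have been above their thresholds. -/
noncomputable def orderTime (M : ℕ) (b : ι → ℝ) (ω : Ω) : ℕ∞ :=
  ⨅ t ∈ {t : ℕ | 1 ≤ t ∧ M ≤ Set.ncard {i | ∃ s ∈ Finset.Icc 1 t, ω ∈ above Y (b i) i s}}, (t : ℕ∞)

variable {Y}

lemma above_anti {b b' : ℝ} (h : b ≤ b') (i : ι) (t : ℕ) : above Y b' i t ⊆ above Y b i t :=
  fun _ hω => lt_of_le_of_lt (ENNReal.ofReal_le_ofReal (Real.exp_le_exp.2 h)) hω

variable [Finite ι] {M : ℕ} {b : ι → ℝ}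

lemma voteTime_mono {b' : ι → ℝ} (h : b ≤ b') (ω : Ω) : voteTime Y M b ω ≤ voteTime Y M b' ω := by
  refine biInf_mono fun t ht => ⟨ht.1, ht.2.trans ?_⟩
  exact Set.ncard_le_ncard (fun i hi => above_anti (h i) i t hi) (Set.toFinite _)

lemma orderTime_mono {b' : ι → ℝ} (h : b ≤ b') (ω : Ω) :
    orderTime Y M b ω ≤ orderTime Y M b' ω := by
  refine biInf_mono fun t ht => ⟨ht.1, ht.2.trans ?_⟩
  exact Set.ncard_le_ncard (fun i ⟨s, hs, hi⟩ => ⟨s, hs, above_anti (h i) i s hi⟩) (Set.toFinite _)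

lemma orderTime_le_voteTime (ω : Ω) : orderTime Y M b ω ≤ voteTime Y M b ω := by
  refine biInf_mono fun t ht => ⟨ht.1, ht.2.trans ?_⟩
  exact Set.ncard_le_ncard (fun i hi => ⟨t, Finset.mem_Icc.2 ⟨ht.1, le_rfl⟩, hi⟩) (Set.toFinite _)

lemma voteTime_le_hitTime {A : Finset ι} (hA : A.card = M) (ω : Ω) :
    voteTime Y M b ω ≤ hitTime Y A b ω := by
  refine biInf_mono fun t ht => ⟨ht.1, ?_⟩
  rw [← hA, ← Set.ncard_coe_finset]
  exact Set.ncard_le_ncard (fun i hi => ht.2 i hi) (Set.toFinite _)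

/-- All sensors of `A` have alarmed by the largest of their hitting times. The cruder sum is used
because its expectation splits. -/
lemma orderTime_le_sum_hitTime {A : Finset ι} (hA : A.card = M) (hM : 1 ≤ M) (ω : Ω) :
    orderTime Y M b ω ≤ ∑ i ∈ A, hitTime Y {i} b ω := by
  by_cases htop : ∃ i ∈ A, hitTime Y {i} b ω = ⊤
  · obtain ⟨i, hi, h⟩ := htop
    calc _ ≤ hitTime Y {i} b ω := by rw [h]; exact le_top
      _ ≤ _ := Finset.single_le_sum (f := fun i => hitTime Y {i} b ω) (fun _ _ => zero_le) hi
  · push Not at htop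
    choose! τ hτ using fun i hi => ENat.ne_top_iff_exists.1 (htop i hi)
    rw [← Finset.sum_congr rfl hτ, ← Nat.cast_sum]
    have hmem : ∀ i ∈ A, 1 ≤ τ i ∧ ω ∈ above Y (b i) i (τ i) := fun i hi => by
      have := mem_of_iInf_eq_coe (hτ i hi).symm
      exact ⟨this.1, this.2 i (Finset.mem_singleton_self i)⟩
    have hle : ∀ i ∈ A, τ i ≤ ∑ j ∈ A, τ j := fun i hi =>
      Finset.single_le_sum (fun _ _ => Nat.zero_le _) hi
    refine iInf₂_le _ ⟨?_, ?_⟩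
    · obtain ⟨i, hi⟩ := Finset.card_pos.1 (hA ▸ hM : 0 < A.card)
      exact (hmem i hi).1.trans (hle i hi)
    · rw [← hA, ← Set.ncard_coe_finset]
      exact Set.ncard_le_ncard (fun i hi => ⟨τ i, Finset.mem_Icc.2 ⟨(hmem i hi).1, hle i hi⟩,
        (hmem i hi).2⟩) (Set.toFinite _)

end Times

section Expectation

variable {Ω : Type*} [MeasurableSpace Ω] {P : Measure Ω}

lemma expTime_mono {ρ ρ' : Ω → ℕ∞} (h : ∀ ω, ρ ω ≤ ρ' ω) : expTime P ρ ≤ expTime P ρ' :=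
  lintegral_mono fun ω => ENat.toENNReal_le.2 (h ω)

lemma mul_le_expTime [IsProbabilityMeasure P] {ρ : Ω → ℕ∞} {B : Set Ω} {x : ℝ≥0∞}
    (h : ∀ ω, ω ∉ B → x ≤ (ρ ω : ℝ≥0∞)) : x * (1 - P B) ≤ expTime P ρ := by
  -- Neither `B` nor `ρ` is assumed measurable, so `B` is replaced by its measurable hull.
  calc x * (1 - P B) = x * P (toMeasurable P B)ᶜ := by
        rw [prob_compl_eq_one_sub (measurableSet_toMeasurable _ _), measure_toMeasurable]
    _ = ∫⁻ ω, (toMeasurable P B)ᶜ.indicator (fun _ => x) ω ∂P := by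
        rw [lintegral_indicator_const (measurableSet_toMeasurable _ _).compl]
    _ ≤ _ := by
        refine lintegral_mono fun ω => ?_
        by_cases hω : ω ∈ (toMeasurable P B)ᶜ
        · rw [Set.indicator_of_mem hω]
          exact h ω fun hB => hω (subset_toMeasurable P B hB)
        · rw [Set.indicator_of_notMem hω]
          exact zero_le

end Expectation

/-! ### Upper bounds by blocks, and the lower bound on the delay -/

namespace IIDModel

variable {ι Ω : Type*} [MeasurableSpace Ω] {Y : ι → ℕ → Ω → ℝ≥0∞}
  {q : ι → Measure ℝ≥0∞} {P : Measure Ω}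

lemma measure_biInter_blockAbove (hM : IIDModel Y q P) (A : Finset ι) (b : ι → ℝ) (m n : ℕ) :
    P (⋂ i ∈ A, blockAbove Y (b i) i m n) =
      ∏ i ∈ A, prodLaw (q i) n (Set.Ioi (ENNReal.ofReal (Real.exp (b i)))) := by
  have hd : ∀ i j : ι, i ≠ j → Disjoint (({i} : Set ι) ×ˢ Set.Ico m (m + n))
      (({j} : Set ι) ×ˢ Set.Ico m (m + n)) := fun i j hij => by
    rw [Set.disjoint_prod]
    exact Or.inl (by simpa using hij)
  have h := hM.measure_biInter A (E := fun i => blockAbove Y (b i) i m n) hd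
    (fun i => measurableSet_blockAbove_sigmaGen (b i) i m n)
  rw [h]
  exact Finset.prod_congr rfl fun i _ => hM.measure_blockAbove _ _ _ _

lemma measurable_hitTime (hM : IIDModel Y q P) (A : Finset ι) (b : ι → ℝ) :
    Measurable fun ω => (hitTime Y A b ω : ℝ≥0∞) := by
  classical
  have hE : ∀ t : ℕ, MeasurableSet {ω | 1 ≤ t ∧ ∀ i ∈ A, ω ∈ above Y (b i) i t} := fun t => by
    have h1 : MeasurableSet (⋂ i ∈ A, above Y (b i) i t) :=
      Finset.measurableSet_biInter _ fun i _ => hM.measurable_expCusum' i t measurableSet_Ioi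
    by_cases ht : 1 ≤ t
    · convert h1 using 1
      ext ω
      simp [ht]
    · simp [ht]
  have heq : (fun ω => (hitTime Y A b ω : ℝ≥0∞)) = fun ω => ⨅ t : ℕ,
      if 1 ≤ t ∧ ∀ i ∈ A, ω ∈ above Y (b i) i t then (t : ℝ≥0∞) else ⊤ := by
    ext1 ω
    refine le_antisymm (le_iInf fun t => ?_) (le_toENNReal_iInf fun t ht => ?_)
    · split_ifs with h
      · rw [← ENat.toENNReal_coe]
        exact ENat.toENNReal_le.2 (iInf₂_le t h)
      · exact le_top
    · refine (iInf_le _ t).trans (le_of_eq (if_pos ?_))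
      exact ht
  rw [heq]
  exact Measurable.iInf fun t => Measurable.ite (hE t) measurable_const measurable_const

/-- Cutting time into blocks of length `n`, each of which succeeds with the same probability. -/
lemma expTime_hitTime_le (hM : IIDModel Y q P) (A : Finset ι) {b : ι → ℝ} (hb : ∀ i, 0 ≤ b i)
    {n : ℕ} (hn : 1 ≤ n) :
    expTime P (hitTime Y A b) ≤
      n * (∏ i ∈ A, prodLaw (q i) n (Set.Ioi (ENNReal.ofReal (Real.exp (b i)))))⁻¹ := by
  have := hM.isProbabilityMeasure
  set p := ∏ i ∈ A, prodLaw (q i) n (Set.Ioi (ENNReal.ofReal (Real.exp (b i)))) with hp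
  set G : ℕ → Set Ω := fun k => ⋂ i ∈ A, blockAbove Y (b i) i (k * n) n with hG
  have hGS : ∀ k, MeasurableSet[sigmaGen Y (Set.univ ×ˢ Set.Ico (k * n) (k * n + n))] (G k)ᶜ := by
    intro k
    refine MeasurableSet.compl (Finset.measurableSet_biInter _ fun i _ => ?_)
    refine sigmaGen_mono ?_ _ (measurableSet_blockAbove_sigmaGen (b i) i (k * n) n)
    exact Set.prod_mono (Set.subset_univ _) le_rfl
  have hGm : ∀ k, MeasurableSet (G k)ᶜ := fun k => hM.sigmaGen_le _ _ (hGS k)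
  have hPG : ∀ k, P (G k)ᶜ = 1 - p := fun k => by
    rw [prob_compl_eq_one_sub (by simpa using (hGm k).compl), hG,
      hM.measure_biInter_blockAbove A b (k * n) n]
  have hp1 : p ≤ 1 := by
    rw [hp, ← hM.measure_biInter_blockAbove A b 0 n]
    exact prob_le_one
  have hdisj : ∀ k l, k ≠ l → Disjoint ((Set.univ : Set ι) ×ˢ Set.Ico (k * n) (k * n + n))
      ((Set.univ : Set ι) ×ˢ Set.Ico (l * n) (l * n + n)) := by
    have key : ∀ k l, k < l → k * n + n ≤ l * n := fun k l hkl => by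
      calc k * n + n = (k + 1) * n := by ring
        _ ≤ l * n := Nat.mul_le_mul_right n hkl
    intro k l hkl
    rw [Set.disjoint_prod]
    refine Or.inr (Set.disjoint_left.2 fun x hx hy => ?_)
    rw [Set.mem_Ico] at hx hy
    rcases lt_or_gt_of_ne hkl with h | h
    · have := key _ _ h
      omega
    · have := key _ _ h
      omega
  have hPF : ∀ k, P (⋂ j ∈ Finset.range k, (G j)ᶜ) = (1 - p) ^ k := fun k => by
    rw [hM.measure_biInter _ hdisj hGS]
    simp [hPG]
  -- Each block with no successful predecessor is charged `n`. If the first success is in block `k`,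
  -- the total is `(k + 1) * n`, the end of that block; with no success the series diverges.
  have hpt : ∀ ω, (hitTime Y A b ω : ℝ≥0∞) ≤
      ∑' k : ℕ, (⋂ j ∈ Finset.range k, (G j)ᶜ).indicator (fun _ => (n : ℝ≥0∞)) ω := by
    classical
    intro ω
    by_cases hex : ∃ k, ω ∈ G k
    · have h1 : ∀ k ∈ Finset.range (Nat.find hex + 1),
          (⋂ j ∈ Finset.range k, (G j)ᶜ).indicator (fun _ => (n : ℝ≥0∞)) ω = n := by
        intro k hk
        refine Set.indicator_of_mem (Set.mem_iInter₂.2 fun j hj => ?_) _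
        refine Nat.find_min hex ?_
        simp only [Finset.mem_range] at hj hk
        omega
      refine le_trans ?_ (ENNReal.sum_le_tsum (Finset.range (Nat.find hex + 1)))
      rw [Finset.sum_congr rfl h1, Finset.sum_const, Finset.card_range, nsmul_eq_mul]
      have h2 : hitTime Y A b ω ≤ ((Nat.find hex * n + n : ℕ) : ℕ∞) := by
        refine iInf₂_le _ ⟨by omega, fun i hi => ?_⟩
        exact blockAbove_subset_above Y (hb i) i _ n (Set.mem_iInter₂.1 (Nat.find_spec hex) i hi)
      refine (ENat.toENNReal_le.2 h2).trans (le_of_eq ?_)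
      simp only [ENat.toENNReal_coe]
      push_cast
      ring
    · push Not at hex
      have h1 : ∀ k, (⋂ j ∈ Finset.range k, (G j)ᶜ).indicator (fun _ => (n : ℝ≥0∞)) ω = n :=
        fun k => Set.indicator_of_mem (Set.mem_iInter₂.2 fun j _ => hex j) _
      simp_rw [h1]
      rw [ENNReal.tsum_const_eq_top_of_ne_zero (by simp; omega)]
      exact le_top
  calc expTime P (hitTime Y A b)
      ≤ ∫⁻ ω, ∑' k : ℕ, (⋂ j ∈ Finset.range k, (G j)ᶜ).indicator (fun _ => (n : ℝ≥0∞)) ω ∂P :=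
        lintegral_mono hpt
    _ = ∑' k : ℕ, n * (1 - p) ^ k := by
        have hms : ∀ k, MeasurableSet (⋂ j ∈ Finset.range k, (G j)ᶜ) := fun k =>
          Finset.measurableSet_biInter _ fun j _ => hGm j
        rw [lintegral_tsum fun k => (measurable_const.indicator (hms k)).aemeasurable]
        refine tsum_congr fun k => ?_
        rw [lintegral_indicator_const (hms k), hPF]
    _ = n * p⁻¹ := by
        rw [ENNReal.tsum_mul_left, ENNReal.tsum_geometric,
          ENNReal.sub_sub_cancel ENNReal.one_ne_top hp1]

end IIDModel

/-- Rounding up costs less than one more factor `d`, as `d ^ 2 * h - d * h` grows without bound. -/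
lemma eventually_ceil_mul_le {d : ℝ} (hd : 1 < d) :
    ∀ᶠ h : ℝ in atTop, 0 < h ∧ d * h ≤ (⌈d * h⌉₊ : ℝ) ∧ (⌈d * h⌉₊ : ℝ) ≤ d ^ 2 * h := by
  have hpos : 0 < d * (d - 1) := mul_pos (by linarith) (by linarith)
  filter_upwards [eventually_gt_atTop 0, eventually_ge_atTop (1 / (d * (d - 1)))] with h h0 h1
  refine ⟨h0, Nat.le_ceil _, ?_⟩
  have h2 := (Nat.ceil_lt_add_one (show 0 ≤ d * h by positivity)).le
  rw [div_le_iff₀ hpos] at h1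
  nlinarith

namespace IIDModel

variable {ι Ω : Type*} [MeasurableSpace Ω] {Y : ι → ℕ → Ω → ℝ≥0∞}
  {q q' : ι → Measure ℝ≥0∞} {P P' : Measure Ω} {a : ι → ℝ}

lemma tendsto_prodLaw_ceil (hM : IIDModel Y q' P) (hL : ∀ i, LRPair (q i) (q' i) (a i)) (i : ι)
    {d : ℝ} (hd : 1 < d) :
    Tendsto (fun h : ℝ => prodLaw (q' i) ⌈d * h⌉₊ (Set.Ioc (ENNReal.ofReal (Real.exp (a i * h)))
      (ENNReal.ofReal (Real.exp (d * a i * ⌈d * h⌉₊))))) atTop (𝓝 1) := by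
  have := (hL i).prob₁
  have ha := (hL i).pos
  have hceil : Tendsto (fun h : ℝ => ⌈d * h⌉₊) atTop atTop :=
    tendsto_nat_ceil_atTop.comp (tendsto_id.const_mul_atTop (by linarith))
  refine tendsto_of_tendsto_of_tendsto_of_le_of_le ((hM.tendsto_prodLaw hL i hd).comp hceil)
    tendsto_const_nhds (fun h => ?_) fun h => ?_
  · refine measure_mono (Set.Ioc_subset_Ioc_left ?_)
    refine ENNReal.ofReal_le_ofReal (Real.exp_le_exp.2 ?_)
    rw [le_div_iff₀ (by linarith)]
    have := Nat.le_ceil (d * h)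
    calc a i * h * d = a i * (d * h) := by ring
      _ ≤ _ := by gcongr
  · have := isProbabilityMeasure_prodLaw (q' i) ⌈d * h⌉₊
    exact prob_le_one

/-- The delay bound: under the post-change law, the statistics in `A` are simultaneously above
their thresholds after a time not much longer than `h`. -/
lemma eventually_expTime_hitTime_le_mul (hM : IIDModel Y q' P)
    (hL : ∀ i, LRPair (q i) (q' i) (a i)) (A : Finset ι) {d : ℝ} (hd : 1 < d) :
    ∀ᶠ h : ℝ in atTop, expTime P (hitTime Y A fun i => a i * h) ≤ ENNReal.ofReal (d ^ 3 * h) := by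
  have hlim : Tendsto (fun h : ℝ => ∏ i ∈ A, prodLaw (q' i) ⌈d * h⌉₊
      (Set.Ioc (ENNReal.ofReal (Real.exp (a i * h)))
      (ENNReal.ofReal (Real.exp (d * a i * ⌈d * h⌉₊))))) atTop (𝓝 1) := by
    have := ENNReal.tendsto_finsetProd_of_ne_top A
      (fun i _ => hM.tendsto_prodLaw_ceil hL i hd) (fun _ _ => ENNReal.one_ne_top)
    simpa using this
  have hlt : ENNReal.ofReal (1 / d) < 1 := by
    rw [← ENNReal.ofReal_one, ENNReal.ofReal_lt_ofReal_iff one_pos]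
    exact (div_lt_one (by linarith)).2 hd
  filter_upwards [hlim.eventually_const_lt hlt, eventually_ceil_mul_le hd] with h h1 h2
  have hn : 1 ≤ ⌈d * h⌉₊ := Nat.one_le_ceil_iff.2 (mul_pos (by linarith) h2.1)
  refine (hM.expTime_hitTime_le A (fun i => mul_nonneg (hL i).pos.le h2.1.le) hn).trans ?_
  have hp : ENNReal.ofReal (1 / d) ≤ ∏ i ∈ A, prodLaw (q' i) ⌈d * h⌉₊
      (Set.Ioi (ENNReal.ofReal (Real.exp (a i * h)))) :=
    h1.le.trans (Finset.prod_le_prod' fun i _ => measure_mono Set.Ioc_subset_Ioi_self)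
  -- Two factors `d` come from the block length, the third from a success probability of at least `1
  -- / d`.
  calc (⌈d * h⌉₊ : ℝ≥0∞) * (∏ i ∈ A, prodLaw (q' i) ⌈d * h⌉₊
        (Set.Ioi (ENNReal.ofReal (Real.exp (a i * h)))))⁻¹
      ≤ ENNReal.ofReal (d ^ 2 * h) * (ENNReal.ofReal (1 / d))⁻¹ := by
        gcongr
        rw [← ENNReal.ofReal_natCast]
        exact ENNReal.ofReal_le_ofReal h2.2.2
    _ = ENNReal.ofReal (d ^ 3 * h) := by
        have hd0 : 0 < d := by linarith
        rw [← ENNReal.ofReal_inv_of_pos (by positivity),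
          ← ENNReal.ofReal_mul (mul_nonneg (by positivity) h2.1.le)]
        congr 1
        field_simp

/-- The bound on the time to a false alarm, by a change of measure. -/
lemma eventually_expTime_hitTime_le_exp (hM : IIDModel Y q P) (hM' : IIDModel Y q' P')
    (hL : ∀ i, LRPair (q i) (q' i) (a i)) {A : Finset ι} (hA : A.Nonempty) {d : ℝ} (hd : 1 < d) :
    ∀ᶠ h : ℝ in atTop, expTime P (hitTime Y A fun i => a i * h) ≤
      ENNReal.ofReal (Real.exp (d ^ 4 * (∑ i ∈ A, a i) * h)) := by
  have hd0 : 0 < d := by linarith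
  have hsum : 0 < ∑ i ∈ A, a i := Finset.sum_pos (fun i _ => (hL i).pos) hA
  have hhalf : ∀ᶠ h : ℝ in atTop, ∀ i ∈ A, (2 : ℝ≥0∞)⁻¹ < prodLaw (q' i) ⌈d * h⌉₊
      (Set.Ioc (ENNReal.ofReal (Real.exp (a i * h)))
      (ENNReal.ofReal (Real.exp (d * a i * ⌈d * h⌉₊)))) := by
    rw [Filter.eventually_all_finset]
    exact fun i _ => (hM'.tendsto_prodLaw_ceil hL i hd).eventually_const_lt
      ENNReal.one_half_lt_one
  have hκ : 0 < (d ^ 4 - d ^ 3) * ∑ i ∈ A, a i := by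
    refine mul_pos ?_ hsum
    have : d ^ 4 - d ^ 3 = d ^ 3 * (d - 1) := by ring
    rw [this]
    exact mul_pos (by positivity) (by linarith)
  -- The block length and the constant `2 ^ A.card` are absorbed by raising the exponent from `d ^
  -- 3` to `d ^ 4`.
  have hpoly : ∀ᶠ h : ℝ in atTop, d ^ 2 * 2 ^ A.card * h ≤
      Real.exp ((d ^ 4 - d ^ 3) * (∑ i ∈ A, a i) * h) := by
    have h1 := (isLittleO_pow_exp_pos_mul_atTop 1 hκ).bound
      (show 0 < 1 / (d ^ 2 * 2 ^ A.card) by positivity)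
    filter_upwards [h1, eventually_gt_atTop 0] with h h2 h3
    rw [pow_one, Real.norm_of_nonneg h3.le, Real.norm_of_nonneg (Real.exp_pos _).le] at h2
    rw [one_div, inv_mul_eq_div, le_div_iff₀ (by positivity)] at h2
    linarith
  filter_upwards [hhalf, eventually_ceil_mul_le hd, hpoly] with h h1 h2 h3
  have hn : 1 ≤ ⌈d * h⌉₊ := Nat.one_le_ceil_iff.2 (mul_pos (by linarith) h2.1)
  refine (hM.expTime_hitTime_le A (fun i => mul_nonneg (hL i).pos.le h2.1.le) hn).trans ?_
  -- Probability one half after the change, divided by the density bound `exp (d * a i * n)` with `n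
  -- ≤ d ^ 2 * h`.
  have hp1 : ∀ i ∈ A, ENNReal.ofReal (2⁻¹ * Real.exp (-(d ^ 3 * a i * h))) ≤
      prodLaw (q i) ⌈d * h⌉₊ (Set.Ioi (ENNReal.ofReal (Real.exp (a i * h)))) := by
    intro i hi
    have ha := (hL i).pos
    have h4 := (h1 i hi).le.trans ((hL i).prodLaw_gt_ge _ _ _)
    rw [← ENNReal.div_le_iff (by simp [Real.exp_pos]) (by simp)] at h4
    refine le_trans ?_ h4
    rw [ENNReal.ofReal_mul (by norm_num), ENNReal.ofReal_inv_of_pos (by norm_num),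
      ENNReal.ofReal_ofNat, div_eq_mul_inv, ← ENNReal.ofReal_inv_of_pos (Real.exp_pos _),
      ← Real.exp_neg]
    refine mul_le_mul_right (ENNReal.ofReal_le_ofReal (Real.exp_le_exp.2 (neg_le_neg ?_))) _
    calc d * a i * ⌈d * h⌉₊ ≤ d * a i * (d ^ 2 * h) := by gcongr; exact h2.2.2
      _ = d ^ 3 * a i * h := by ring
  have hp : ENNReal.ofReal ((2⁻¹ : ℝ) ^ A.card * Real.exp (-(d ^ 3 * (∑ i ∈ A, a i) * h))) ≤
      ∏ i ∈ A, prodLaw (q i) ⌈d * h⌉₊ (Set.Ioi (ENNReal.ofReal (Real.exp (a i * h)))) := by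
    refine le_trans (le_of_eq ?_) (Finset.prod_le_prod' hp1)
    rw [← ENNReal.ofReal_prod_of_nonneg fun _ _ => by positivity, Finset.prod_mul_distrib,
      Finset.prod_const, ← Real.exp_sum, Finset.sum_neg_distrib, ← Finset.sum_mul,
      ← Finset.mul_sum]
  calc (⌈d * h⌉₊ : ℝ≥0∞) * (∏ i ∈ A, prodLaw (q i) ⌈d * h⌉₊
        (Set.Ioi (ENNReal.ofReal (Real.exp (a i * h)))))⁻¹
      ≤ ENNReal.ofReal (d ^ 2 * h) * (ENNReal.ofReal
          ((2⁻¹ : ℝ) ^ A.card * Real.exp (-(d ^ 3 * (∑ i ∈ A, a i) * h))))⁻¹ := by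
        gcongr
        rw [← ENNReal.ofReal_natCast]
        exact ENNReal.ofReal_le_ofReal h2.2.2
    _ = ENNReal.ofReal (d ^ 2 * 2 ^ A.card * h * Real.exp (d ^ 3 * (∑ i ∈ A, a i) * h)) := by
        rw [← ENNReal.ofReal_inv_of_pos (by positivity),
          ← ENNReal.ofReal_mul (mul_nonneg (by positivity) h2.1.le), mul_inv, ← Real.exp_neg,
          neg_neg, inv_pow, inv_inv]
        congr 1
        ring
    _ ≤ _ := by
        refine ENNReal.ofReal_le_ofReal ?_
        calc _ ≤ Real.exp ((d ^ 4 - d ^ 3) * (∑ i ∈ A, a i) * h) *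
              Real.exp (d ^ 3 * (∑ i ∈ A, a i) * h) := by gcongr
          _ = _ := by rw [← Real.exp_add]; ring_nf

/-- The delay of the `M`-th alarm is asymptotically at least `h`. -/
lemma eventually_le_expTime_orderTime [Finite ι] (hM : IIDModel Y q' P)
    (hL : ∀ i, LRPair (q i) (q' i) (a i)) {M : ℕ} (hM1 : 1 ≤ M) {d : ℝ} (hd : 1 < d) :
    ∀ᶠ h : ℝ in atTop, ENNReal.ofReal (h / d) ≤
      expTime P (orderTime Y M fun i => a i * h) := by
  have := hM.isProbabilityMeasure
  -- With `1 / d < c < 1`, no sensor crosses before `c * h` with probability at least `1 / (d * c)`;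
  -- the product of the two is `h / d`.
  set c := (1 / d + 1) / 2 with hc
  have h1d : 1 / d < 1 := (div_lt_one (by linarith)).2 hd
  have h1d0 : 0 < 1 / d := by positivity
  have hc1 : c < 1 := by rw [hc]; linarith
  have hc0 : 0 < c := by rw [hc]; linarith
  have hdc : 1 / d < c := by rw [hc]; linarith
  have hr : 0 < 1 - 1 / (d * c) := by
    have : 1 < d * c := by
      rw [div_lt_iff₀ (by linarith)] at hdc
      linarith
    rw [sub_pos, div_lt_one (by linarith)]
    exact this
  have hlim := hM.tendsto_measure_early hL hc0 hc1
  filter_upwards [hlim.eventually_lt_const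
      (show 0 < ENNReal.ofReal (1 - 1 / (d * c)) by simpa using hr),
    eventually_gt_atTop 0] with h h1 h2
  refine le_trans ?_ (mul_le_expTime (x := ENNReal.ofReal (c * h))
    (B := {ω | ∃ i, ∃ t : ℕ, (t : ℝ) ≤ c * h ∧ ω ∈ above Y (a i * h) i t}) ?_)
  · have h3 : ENNReal.ofReal (1 / (d * c)) ≤
        1 - P {ω | ∃ i, ∃ t : ℕ, (t : ℝ) ≤ c * h ∧ ω ∈ above Y (a i * h) i t} := by
      refine le_trans (le_of_eq ?_) (tsub_le_tsub_left h1.le 1)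
      rw [← ENNReal.ofReal_one, ← ENNReal.ofReal_sub _ hr.le]
      congr 1
      ring
    refine le_trans (le_of_eq ?_) (mul_le_mul_right h3 _)
    rw [← ENNReal.ofReal_mul (by positivity)]
    congr 1
    field_simp
  · intro ω hω
    refine le_toENNReal_iInf fun t ht => ?_
    obtain ⟨i, s, hs, hi⟩ : {i | ∃ s ∈ Finset.Icc 1 t, ω ∈ above Y (a i * h) i s}.Nonempty :=
      (Set.ncard_pos (Set.toFinite _)).1 (lt_of_lt_of_le hM1 ht.2)
    rw [← ENNReal.ofReal_natCast]
    refine ENNReal.ofReal_le_ofReal ?_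
    by_contra! hcon
    refine hω ⟨i, s, ?_, hi⟩
    have : (s : ℝ) ≤ t := by exact_mod_cast (Finset.mem_Icc.1 hs).2
    linarith

end IIDModel

/-! ### The cheapest sets of sensors and lower bounds on the false alarm time -/

/-- `A` consists of the indices of the smallest values of `a`, and `c` is the largest value of `a`
on `A`. -/
structure IsLowest {ι : Type*} (a : ι → ℝ) (A : Finset ι) (c : ℝ) : Prop where
  exists_eq : ∃ i ∈ A, a i = c
  le : ∀ i ∈ A, a i ≤ c
  ge : ∀ i ∉ A, c ≤ a i

namespace IsLowest

variable {ι : Type*} {a : ι → ℝ} {A B : Finset ι} {c : ℝ}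

lemma nonempty (h : IsLowest a A c) : A.Nonempty := h.exists_eq.imp fun _ hi => hi.1

/-- Otherwise `B` would lie in `A` with an index attaining `c` removed, which is too small. -/
lemma exists_ge (h : IsLowest a A c) (hB : A.card ≤ B.card) : ∃ i ∈ B, c ≤ a i := by
  classical
  by_contra! hcon
  obtain ⟨i, hi, hic⟩ := h.exists_eq
  have hBA : B ⊆ A.erase i := fun j hj => by
    refine Finset.mem_erase.2 ⟨?_, ?_⟩
    · rintro rfl
      exact absurd (hcon _ hj) (by rw [hic]; exact lt_irrefl c)
    · by_contra hjA
      exact absurd (h.ge j hjA) (not_le.2 (hcon j hj))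
  have h1 := Finset.card_le_card hBA
  rw [Finset.card_erase_of_mem hi] at h1
  have := Finset.card_pos.2 ⟨i, hi⟩
  omega

/-- Exchange argument: `A \ B` and `B \ A` have equal size, and `c` separates their values. -/
lemma sum_le (h : IsLowest a A c) (hB : A.card = B.card) : ∑ i ∈ A, a i ≤ ∑ i ∈ B, a i := by
  classical
  have h1 : ∑ i ∈ A \ B, a i ≤ (A \ B).card * c := by
    rw [← nsmul_eq_mul]
    exact Finset.sum_le_card_nsmul _ _ _ fun i hi => h.le i (Finset.mem_sdiff.1 hi).1
  have h2 : ((B \ A).card : ℝ) * c ≤ ∑ i ∈ B \ A, a i := by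
    rw [← nsmul_eq_mul]
    exact Finset.card_nsmul_le_sum _ _ _ fun i hi => h.ge i (Finset.mem_sdiff.1 hi).2
  rw [Finset.card_sdiff_comm hB] at h1
  rw [← Finset.sum_inter_add_sum_sdiff A B, ← Finset.sum_inter_add_sum_sdiff B A,
    Finset.inter_comm B A]
  linarith

end IsLowest

section ExpLower

variable {Ω : Type*} [MeasurableSpace Ω] {P : Measure Ω} [IsProbabilityMeasure P]

/-- If the probability that `ρ h` is below `x` is at most `x * K * exp (-θ * κ * h)` for
all `θ < 1`, then the expectation of `ρ h` grows at least like `exp (κ * h)`. -/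
lemma eventually_exp_le_expTime {ρ : ℝ → Ω → ℕ∞} {κ : ℝ} (hκ : 0 < κ)
    (H : ∀ θ : ℝ, 0 < θ → θ < 1 → ∃ K : ℝ, 0 < K ∧ ∀ h : ℝ, 0 ≤ h → ∀ x : ℝ, 0 ≤ x →
      ∃ B : Set Ω, P B ≤ ENNReal.ofReal (x * (K * Real.exp (-(θ * κ * h)))) ∧
        ∀ ω, ω ∉ B → ENNReal.ofReal x ≤ (ρ h ω : ℝ≥0∞)) {d : ℝ} (hd : 1 < d) :
    ∀ᶠ h : ℝ in atTop, ENNReal.ofReal (Real.exp (κ * h / d)) ≤ expTime P (ρ h) := by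
  have h1d : 1 / d < 1 := (div_lt_one (by linarith)).2 hd
  have h1d0 : 0 < 1 / d := by positivity
  obtain ⟨K, hK, hB⟩ := H ((1 / d + 1) / 2) (by linarith) (by linarith)
  have hη : 0 < ((1 / d + 1) / 2 - 1 / d) * κ := mul_pos (by linarith) hκ
  have hlim : Tendsto (fun h : ℝ => Real.exp (((1 / d + 1) / 2 - 1 / d) * κ * h)) atTop atTop :=
    Real.tendsto_exp_atTop.comp (tendsto_id.const_mul_atTop hη)
  filter_upwards [eventually_ge_atTop 0, hlim.eventually_ge_atTop (4 * K)] with h h0 h1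
  -- This `x` gives the bad event probability at most `1 / 2`; the gap between `θ` and `1 / d` in
  -- the exponent then pays for the factor `4 * K`.
  set x := Real.exp ((1 / d + 1) / 2 * κ * h) / (2 * K) with hx
  obtain ⟨B, hPB, hBρ⟩ := hB h h0 x (by positivity)
  refine le_trans ?_ (mul_le_expTime hBρ)
  have h2 : x * (K * Real.exp (-((1 / d + 1) / 2 * κ * h))) = 1 / 2 := by
    rw [hx, Real.exp_neg]
    have := Real.exp_pos ((1 / d + 1) / 2 * κ * h)
    field_simp
  rw [h2] at hPB
  have h3 : ENNReal.ofReal (1 / 2) ≤ 1 - P B := by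
    refine le_trans (le_of_eq ?_) (tsub_le_tsub_left hPB 1)
    rw [← ENNReal.ofReal_one, ← ENNReal.ofReal_sub _ (by norm_num)]
    norm_num
  refine le_trans ?_ (mul_le_mul_right h3 _)
  rw [← ENNReal.ofReal_mul (by positivity)]
  refine ENNReal.ofReal_le_ofReal ?_
  have h4 : Real.exp ((1 / d + 1) / 2 * κ * h) =
      Real.exp (((1 / d + 1) / 2 - 1 / d) * κ * h) * Real.exp (κ * h / d) := by
    rw [← Real.exp_add]
    ring_nf
  rw [hx, h4]
  have h5 := Real.exp_pos (κ * h / d)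
  rw [div_mul_div_comm, le_div_iff₀ (by positivity)]
  nlinarith

end ExpLower

/-- A union bound over the natural numbers `1 ≤ t < x`. -/
lemma measure_biUnion_Ico_ceil_le {Ω : Type*} [MeasurableSpace Ω] (P : Measure Ω) {E : ℕ → Set Ω}
    {r : ℝ} (hr : 0 ≤ r) (hE : ∀ t, P (E t) ≤ ENNReal.ofReal r) {x : ℝ} (hx : 0 ≤ x) :
    P (⋃ t ∈ Finset.Ico 1 ⌈x⌉₊, E t) ≤ ENNReal.ofReal (x * r) := by
  refine (measure_biUnion_finset_le _ _).trans ((Finset.sum_le_sum fun t _ => hE t).trans ?_)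
  rw [Finset.sum_const, nsmul_eq_mul, ← ENNReal.ofReal_natCast,
    ← ENNReal.ofReal_mul (by positivity)]
  refine ENNReal.ofReal_le_ofReal (mul_le_mul_of_nonneg_right ?_ hr)
  rw [Nat.card_Ico]
  rcases Nat.eq_zero_or_pos ⌈x⌉₊ with h | h
  · simpa [h] using hx
  · rw [Nat.cast_sub h]
    have := Nat.ceil_lt_add_one hx
    push_cast
    linarith

namespace IIDModel

variable {ι Ω : Type*} [MeasurableSpace Ω] {Y : ι → ℕ → Ω → ℝ≥0∞}
  {q q' : ι → Measure ℝ≥0∞} {P : Measure Ω} {a : ι → ℝ} {A : Finset ι} {c : ℝ}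

/-- Any `A.card` alarms include one from a sensor with `c ≤ a i`, so a union bound over those
sensors and over time suffices. -/
lemma eventually_exp_le_expTime_orderTime [Finite ι] (hM : IIDModel Y q P)
    (hL : ∀ i, LRPair (q i) (q' i) (a i)) (hA : IsLowest a A c) {d : ℝ} (hd : 1 < d) :
    ∀ᶠ h : ℝ in atTop, ENNReal.ofReal (Real.exp (c * h / d)) ≤
      expTime P (orderTime Y A.card fun i => a i * h) := by
  have := hM.isProbabilityMeasure
  have := Fintype.ofFinite ι
  classical
  have hc : 0 < c := by
    obtain ⟨i, -, rfl⟩ := hA.exists_eq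
    exact (hL i).pos
  refine eventually_exp_le_expTime hc (fun θ h0 h1 => ?_) hd
  obtain ⟨K, hK, htail⟩ := hM.exists_tail_bound hL h0 h1
  refine ⟨(Fintype.card ι + 1) * K, by positivity, fun h hh x hx => ?_⟩
  refine ⟨_, measure_biUnion_Ico_ceil_le P (E := fun t =>
    ⋃ i ∈ Finset.univ.filter fun i => c ≤ a i, above Y (a i * h) i t) (by positivity)
    (fun t => ?_) hx, fun ω hω => ?_⟩
  · have hle : ∀ i ∈ Finset.univ.filter fun i => c ≤ a i, P (above Y (a i * h) i t) ≤
        ENNReal.ofReal (K * Real.exp (-(θ * c * h))) := fun i hi => by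
      refine (htail i t _).trans (ENNReal.ofReal_le_ofReal ?_)
      have hi' := (Finset.mem_filter.1 hi).2
      have : θ * c * h ≤ θ * (a i * h) := by
        rw [mul_assoc]
        gcongr
      gcongr
    refine (measure_biUnion_finset_le _ _).trans ((Finset.sum_le_sum hle).trans ?_)
    rw [Finset.sum_const, nsmul_eq_mul, ← ENNReal.ofReal_natCast,
      ← ENNReal.ofReal_mul (by positivity), mul_assoc (_ + 1 : ℝ)]
    refine ENNReal.ofReal_le_ofReal (mul_le_mul_of_nonneg_right ?_ (by positivity))
    have : (((Finset.univ.filter fun i => c ≤ a i).card : ℕ) : ℝ) ≤ Fintype.card ι := by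
      exact_mod_cast Finset.card_le_univ _
    linarith
  · refine le_toENNReal_iInf fun t ht => ?_
    have ht2 := ht.2
    rw [Set.ncard_eq_toFinset_card'] at ht2
    obtain ⟨i, hi, hci⟩ := hA.exists_ge ht2
    obtain ⟨s, hs, hsi⟩ := Set.mem_toFinset.1 hi
    rw [Finset.mem_Icc] at hs
    rw [← ENNReal.ofReal_natCast]
    refine ENNReal.ofReal_le_ofReal ?_
    by_contra! hcon
    refine hω (Set.mem_iUnion₂.2 ⟨s, Finset.mem_Ico.2 ⟨hs.1, Nat.lt_ceil.2 ?_⟩,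
      Set.mem_iUnion₂.2 ⟨i, by simpa using hci, hsi⟩⟩)
    have : (s : ℝ) ≤ t := by exact_mod_cast hs.2
    linarith

/-- The union bound runs over times and over sets of `A.card` sensors. By independence the tails
multiply over a set, and `A` has the smallest total exponent. -/
lemma eventually_exp_le_expTime_voteTime [Finite ι] (hM : IIDModel Y q P)
    (hL : ∀ i, LRPair (q i) (q' i) (a i)) (hA : IsLowest a A c) {d : ℝ} (hd : 1 < d) :
    ∀ᶠ h : ℝ in atTop, ENNReal.ofReal (Real.exp ((∑ i ∈ A, a i) * h / d)) ≤
      expTime P (voteTime Y A.card fun i => a i * h) := by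
  have := hM.isProbabilityMeasure
  have := Fintype.ofFinite ι
  classical
  have hsum : 0 < ∑ i ∈ A, a i := Finset.sum_pos (fun i _ => (hL i).pos) hA.nonempty
  refine eventually_exp_le_expTime hsum (fun θ h0 h1 => ?_) hd
  obtain ⟨K, hK, htail⟩ := hM.exists_tail_bound hL h0 h1
  refine ⟨((Finset.powersetCard A.card (Finset.univ : Finset ι)).card + 1) * K ^ A.card,
    by positivity, fun h hh x hx => ?_⟩
  refine ⟨_, measure_biUnion_Ico_ceil_le P (E := fun t =>
    ⋃ B ∈ Finset.powersetCard A.card (Finset.univ : Finset ι), ⋂ i ∈ B, above Y (a i * h) i t)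
    (by positivity) (fun t => ?_) hx, fun ω hω => ?_⟩
  · have hd : ∀ i j : ι, i ≠ j → Disjoint (({i} : Set ι) ×ˢ Set.Iio t)
        (({j} : Set ι) ×ˢ Set.Iio t) := fun i j hij => by
      rw [Set.disjoint_prod]
      exact Or.inl (by simpa using hij)
    have hle : ∀ B ∈ Finset.powersetCard A.card (Finset.univ : Finset ι),
        P (⋂ i ∈ B, above Y (a i * h) i t) ≤
        ENNReal.ofReal (K ^ A.card * Real.exp (-(θ * (∑ i ∈ A, a i) * h))) := fun B hB => by
      have hcard := (Finset.mem_powersetCard.1 hB).2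
      have hind := hM.measure_biInter B (E := fun i => above Y (a i * h) i t) hd
        (fun i => measurableSet_above_sigmaGen (a i * h) i t)
      rw [hind]
      refine (Finset.prod_le_prod' fun i _ => htail i t (a i * h)).trans ?_
      rw [← ENNReal.ofReal_prod_of_nonneg fun _ _ => by positivity, Finset.prod_mul_distrib,
        Finset.prod_const, ← Real.exp_sum, hcard]
      refine ENNReal.ofReal_le_ofReal ?_
      have hs := hA.sum_le hcard.symm
      have : θ * (∑ i ∈ A, a i) * h ≤ ∑ i ∈ B, θ * (a i * h) := by
        rw [← Finset.mul_sum, ← Finset.sum_mul, mul_assoc]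
        gcongr
      rw [Finset.sum_neg_distrib]
      gcongr
    refine (measure_biUnion_finset_le _ _).trans ((Finset.sum_le_sum hle).trans ?_)
    rw [Finset.sum_const, nsmul_eq_mul, ← ENNReal.ofReal_natCast,
      ← ENNReal.ofReal_mul (by positivity), mul_assoc (_ + 1 : ℝ)]
    exact ENNReal.ofReal_le_ofReal (mul_le_mul_of_nonneg_right (by linarith) (by positivity))
  · refine le_toENNReal_iInf fun t ht => ?_
    have ht2 := ht.2
    rw [Set.ncard_eq_toFinset_card'] at ht2
    obtain ⟨B, hB, hcard⟩ := Finset.exists_subset_card_eq ht2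
    rw [← ENNReal.ofReal_natCast]
    refine ENNReal.ofReal_le_ofReal ?_
    by_contra! hcon
    refine hω (Set.mem_iUnion₂.2 ⟨t, Finset.mem_Ico.2 ⟨ht.1, Nat.lt_ceil.2 hcon⟩,
      Set.mem_iUnion₂.2 ⟨B, by simp [Finset.mem_powersetCard, hcard],
        Set.mem_iInter₂.2 fun i hi => by simpa using hB hi⟩⟩)

end IIDModel

/-! ### Inversion of the exponential growth -/

section Asymptotic

lemma isEquivalent_of_forall_ratio {α : Type*} {F : Filter α} {u v : α → ℝ}
    (hu : ∀ᶠ x in F, 0 < u x)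
    (H : ∀ d : ℝ, 1 < d → ∀ᶠ x in F, u x / d ≤ v x ∧ v x ≤ d * u x) : v ~[F] u := by
  refine isLittleO_iff.2 fun ε hε => ?_
  filter_upwards [hu, H (1 + ε) (by linarith)] with x h0 h
  rw [Pi.sub_apply, Real.norm_eq_abs, Real.norm_of_nonneg h0.le, abs_le]
  rw [div_le_iff₀ (by linarith)] at h
  constructor
  · by_contra! hcon
    have : v x * (1 + ε) < (1 - ε) * u x * (1 + ε) :=
      mul_lt_mul_of_pos_right (by linarith) (by linarith)
    nlinarith [mul_pos (mul_pos hε hε) h0]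
  · linarith [h.2]

/-- Inversion of the exponential growth of the expected time to a false alarm. -/
lemma threshold_and_delay_asymptotics {T D : ℝ → ℝ≥0∞} {κ : ℝ} (hκ : 0 < κ) (hT : Monotone T)
    (hTlow : ∀ d : ℝ, 1 < d → ∀ᶠ h : ℝ in atTop, ENNReal.ofReal (Real.exp (κ * h / d)) ≤ T h)
    (hTup : ∀ d : ℝ, 1 < d → ∀ᶠ h : ℝ in atTop, T h ≤ ENNReal.ofReal (Real.exp (d * κ * h)))
    (hDlow : ∀ d : ℝ, 1 < d → ∀ᶠ h : ℝ in atTop, ENNReal.ofReal (h / d) ≤ D h)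
    (hDup : ∀ d : ℝ, 1 < d → ∀ᶠ h : ℝ in atTop, D h ≤ ENNReal.ofReal (d * h))
    {F : Filter ℝ} (hF : F ≤ atTop) {u : ℝ → ℝ}
    (hu : ∀ᶠ γ in F, T (u γ) = ENNReal.ofReal γ) :
    u ~[F] (fun γ => Real.log γ / κ) ∧ (∀ᶠ γ in F, D (u γ) < ⊤) ∧
      (fun γ => (D (u γ)).toReal) ~[F] fun γ => Real.log γ / κ := by
  -- By monotonicity of `T`, thresholds below `x` keep `T (u γ)` below a fixed finite bound, which
  -- `γ` eventually exceeds.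
  have hlim : Tendsto u F atTop := by
    refine tendsto_atTop.2 fun x => ?_
    obtain ⟨h₀, hfin, hx⟩ := ((hTup 2 one_lt_two).and (eventually_ge_atTop x)).exists
    filter_upwards [hu, hF (eventually_gt_atTop (Real.exp (2 * κ * h₀)))] with γ h1 h2
    by_contra! hcon
    have h3 := (hT (hcon.le.trans hx)).trans hfin
    rw [h1, ENNReal.ofReal_le_ofReal_iff (Real.exp_pos _).le] at h3
    linarith
  have hpos : ∀ᶠ γ in F, 0 < u γ := hlim.eventually_gt_atTop 0
  have hlog : (fun γ => Real.log γ / κ) ~[F] u := by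
    refine isEquivalent_of_forall_ratio hpos fun d hd => ?_
    filter_upwards [hu, hF (eventually_gt_atTop 0), hlim.eventually (hTlow d hd),
      hlim.eventually (hTup d hd)] with γ h1 h2 h3 h4
    rw [h1] at h3 h4
    rw [ENNReal.ofReal_le_ofReal_iff h2.le, ← Real.le_log_iff_exp_le h2] at h3
    rw [ENNReal.ofReal_le_ofReal_iff (Real.exp_pos _).le, ← Real.log_le_iff_le_exp h2] at h4
    rw [le_div_iff₀ hκ, div_le_iff₀ hκ]
    constructor
    · calc u γ / d * κ = κ * u γ / d := by ring
        _ ≤ _ := h3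
    · calc Real.log γ ≤ d * κ * u γ := h4
        _ = _ := by ring
  have hdel : (fun γ => (D (u γ)).toReal) ~[F] u := by
    refine isEquivalent_of_forall_ratio hpos fun d hd => ?_
    filter_upwards [hpos, hlim.eventually (hDlow d hd), hlim.eventually (hDup d hd)]
      with γ h1 h2 h3
    have hfin : D (u γ) ≠ ⊤ := ne_top_of_le_ne_top ENNReal.ofReal_ne_top h3
    have hd0 : 0 ≤ d * u γ := mul_nonneg (by linarith) h1.le
    exact ⟨(ENNReal.ofReal_le_iff_le_toReal hfin).1 h2, ENNReal.toReal_le_of_le_ofReal hd0 h3⟩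
  refine ⟨hlog.symm, ?_, hdel.trans hlog.symm⟩
  filter_upwards [hlim.eventually (hDup 2 one_lt_two)] with γ h
  exact lt_of_le_of_lt h ENNReal.ofReal_lt_top

lemma exists_one_lt_pow_eq {d : ℝ} (hd : 1 < d) {n : ℕ} (hn : n ≠ 0) :
    ∃ e : ℝ, 1 < e ∧ e ^ n = d :=
  ⟨d ^ ((n : ℝ)⁻¹), Real.one_lt_rpow hd (by positivity),
    Real.rpow_inv_natCast_pow (by linarith) hn⟩

end Asymptotic

/-! ### The sensors in order of their divergence -/

section Sensors

variable {L : ℕ} (N : Fin L → ℕ)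

lemma lam_mono : Monotone (lam N) := by
  intro m m' h
  refine Finset.min'_le _ _ ?_
  have h1 := ((lam_eq_iff N m' _).1 rfl).2
  have h2 : (m : ℕ) ≤ m' := h
  simpa using h2.trans h1

/-- The group-by-group listing is `finSigmaFinEquiv`, which counts from `0`; hence the shift by one.
-/
lemma exists_equiv_lam :
    ∃ e : Finset.Icc 1 (∑ l, N l) ≃ Sensor N, ∀ m, (e m).1 = lam N m := by
  let e : Finset.Icc 1 (∑ l, N l) ≃ Sensor N :=
    { toFun := fun m => finSigmaFinEquiv.symm ⟨m - 1, by
        have := Finset.mem_Icc.1 m.2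
        omega⟩
      invFun := fun i => ⟨finSigmaFinEquiv i + 1, by
        have := (finSigmaFinEquiv i).2
        exact Finset.mem_Icc.2 ⟨by omega, by omega⟩⟩
      left_inv := fun m => by
        have := Finset.mem_Icc.1 m.2
        ext
        simp only [Equiv.apply_symm_apply]
        omega
      right_inv := fun i => by simp [-finSigmaFinEquiv_apply] }
  refine ⟨e, fun m => ?_⟩
  obtain ⟨i, rfl⟩ := e.symm.surjective m
  rw [Equiv.apply_symm_apply, eq_comm, lam_eq_iff]
  have h1 : ((e.symm i : Finset.Icc 1 (∑ l, N l)) : ℕ) = (finSigmaFinEquiv i : ℕ) + 1 := rfl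
  have h2 : ∑ j ∈ Finset.Iio i.1, N j =
      ∑ j : Fin i.1, N (Fin.castLE i.1.2.le j) := by
    symm
    refine Finset.sum_nbij (Fin.castLE i.1.2.le) (fun j _ => ?_) (fun j _ k _ h => ?_)
      (fun j hj => ?_) fun _ _ => rfl
    · simp [Fin.lt_def]
    · simpa [Fin.ext_iff] using h
    · have hj' : j < i.1 := by simpa using hj
      exact ⟨⟨j, hj'⟩, by simp, rfl⟩
  have h3 : ∑ j ∈ Finset.Iic i.1, N j = N i.1 + ∑ j ∈ Finset.Iio i.1, N j := by
    rw [← Finset.Iio_insert, Finset.sum_insert (by simp)]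
  rw [h1, h3, h2, finSigmaFinEquiv_apply]
  have := i.2.2
  omega

lemma exists_isLowest {a : Fin L → ℝ} (ha : Monotone a) (M : Finset.Icc 1 (∑ l, N l)) :
    ∃ A : Finset (Sensor N), A.card = M ∧ IsLowest (fun i : Sensor N => a i.1) A (a (lam N M)) ∧
      ∑ i ∈ A, a i.1 = ∑ m : Finset.Icc 1 (∑ l, N l) with m ≤ M, a (lam N m) := by
  obtain ⟨e, he⟩ := exists_equiv_lam N
  refine ⟨(Finset.univ.filter fun m => m ≤ M).map e.toEmbedding, ?_, ⟨?_, ?_, ?_⟩, ?_⟩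
  · have h1 := Finset.mem_Icc.1 M.2
    have h2 : (Finset.univ.filter fun m : Finset.Icc 1 (∑ l, N l) => m ≤ M).map
        (Function.Embedding.subtype _) = Finset.Icc 1 (M : ℕ) := by
      ext x
      simp only [Finset.mem_map, Finset.mem_filter, Finset.mem_univ, true_and,
        Function.Embedding.subtype_apply, Finset.mem_Icc]
      constructor
      · rintro ⟨m, hm, rfl⟩
        exact ⟨(Finset.mem_Icc.1 m.2).1, hm⟩
      · rintro ⟨hx, hx'⟩
        exact ⟨⟨x, Finset.mem_Icc.2 ⟨hx, hx'.trans h1.2⟩⟩, hx', rfl⟩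
    rw [Finset.card_map, ← Finset.card_map (Function.Embedding.subtype _), h2]
    simp
  · exact ⟨e M, by simp, by rw [he]⟩
  · intro i hi
    obtain ⟨m, hm, rfl⟩ := Finset.mem_map.1 hi
    rw [Equiv.coe_toEmbedding, he]
    exact ha (lam_mono N (Finset.mem_filter.1 hm).2)
  · intro i hi
    obtain ⟨m, rfl⟩ := e.surjective i
    rw [he]
    refine ha (lam_mono N (le_of_lt (not_le.1 fun hm => hi ?_)))
    exact Finset.mem_map.2 ⟨m, by simpa using hm, rfl⟩
  · rw [Finset.sum_map]
    simp [he]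

end Sensors

/-! ### From the extended real statistics to likelihood ratios -/

section Bridge

variable {L : ℕ} {N : Fin L → ℕ} {S : Fin L → Type*} [∀ l, MeasurableSpace (S l)]
  {Ω : Type*} (f g : ∀ l, Measure (S l)) (X : ∀ i : Sensor N, ℕ → Ω → S i.1)

/-- The likelihood ratio of the observation of sensor `i` at time `t + 1`. -/
noncomputable def likelihood (i : Sensor N) (t : ℕ) (ω : Ω) : ℝ≥0∞ :=
  (g i.1).rnDeriv (f i.1) (X i (t + 1) ω)

/-- Exponentiating turns log-ratios, possibly `⊥`, into factors in `[0, ∞]`. The conventions `⊥ + ⊤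
= ⊥` and `0 * ⊤ = 0` agree, so no side condition arises. -/
lemma exp_cusum (i : Sensor N) (t : ℕ) (ω : Ω) :
    EReal.exp (cusum f g X i t ω) = expCusum (fun s => likelihood f g X i s ω) t := by
  induction t with
  | zero => simp [cusum, expCusum]
  | succ t ih =>
    rw [cusum, EReal.exp_add, EReal.exp_monotone.map_max, ih, EReal.exp_zero, LLR,
      ENNReal.exp_log]
    rfl

lemma lt_cusum_iff (b : ℝ) (i : Sensor N) (t : ℕ) (ω : Ω) :
    (b : EReal) < cusum f g X i t ω ↔ ω ∈ above (likelihood f g X) b i t := by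
  rw [← EReal.exp_lt_exp_iff, exp_cusum, EReal.exp_coe]
  rfl

lemma votingTime_eq (M : ℕ) (h : Fin L → ℝ) :
    votingTime f g X M h = voteTime (likelihood f g X) M fun i => h i.1 := by
  ext1 ω
  simp only [votingTime, voteTime, lt_cusum_iff]

lemma alarmTime_eq (M : ℕ) (h : Fin L → ℝ) :
    alarmTime f g X M h = orderTime (likelihood f g X) M fun i => h i.1 := by
  ext1 ω
  simp only [alarmTime, orderTime, Finset.lt_sup_iff, lt_cusum_iff]

variable {f g X} [MeasurableSpace Ω]

/-- The hypothesis `hp` asks for one law at all times; it is met by `ν = ⊤` and `ν = 0`. -/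
lemma IsChangeModel.iidModel {ν : ℕ∞} {P : Measure Ω} {p : ∀ l, Measure (S l)}
    (hP : IsChangeModel f g X ν P) (hp : ∀ (i : Sensor N) t, P.map (X i (t + 1)) = p i.1) :
    IIDModel (likelihood f g X)
      (fun i => (p i.1).map ((g i.1).rnDeriv (f i.1))) P where
  measurable i t := (Measure.measurable_rnDeriv _ _).comp (hP.measurable i _ (by omega))
  law i t := by
    rw [← hp i t, Measure.map_map (Measure.measurable_rnDeriv _ _) (hP.measurable i _ (by omega))]
    rfl
  indep := hP.indep.comp (fun q x => (g q.1.1).rnDeriv (f q.1.1) x)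
    fun _ => Measure.measurable_rnDeriv _ _

end Bridge

/-! ### Asymptotics of the two rules -/

namespace IIDModel

variable {ι Ω : Type*} [Finite ι] [MeasurableSpace Ω] {Y : ι → ℕ → Ω → ℝ≥0∞}
  {q q' : ι → Measure ℝ≥0∞} {P P' : Measure Ω} {a : ι → ℝ} {A : Finset ι} {c : ℝ}
  {F : Filter ℝ} {u : ℝ → ℝ}

/-- The voting time lies between the alarm time, which bounds the delay below, and the hitting time
of `A`, which gives both upper bounds. -/
lemma voteTime_asymptotics (hM : IIDModel Y q P) (hM' : IIDModel Y q' P')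
    (hL : ∀ i, LRPair (q i) (q' i) (a i)) (hA : IsLowest a A c) (hF : F ≤ atTop)
    (hu : ∀ᶠ γ in F, expTime P (voteTime Y A.card fun i => a i * u γ) = ENNReal.ofReal γ) :
    u ~[F] (fun γ => Real.log γ / ∑ i ∈ A, a i) ∧
      (∀ᶠ γ in F, expTime P' (voteTime Y A.card fun i => a i * u γ) < ⊤) ∧
      (fun γ => (expTime P' (voteTime Y A.card fun i => a i * u γ)).toReal)
        ~[F] fun γ => Real.log γ / ∑ i ∈ A, a i := by
  refine threshold_and_delay_asymptotics
    (T := fun h => expTime P (voteTime Y A.card fun i => a i * h))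
    (D := fun h => expTime P' (voteTime Y A.card fun i => a i * h))
    (Finset.sum_pos (fun i _ => (hL i).pos) hA.nonempty) ?_
    (fun d hd => hM.eventually_exp_le_expTime_voteTime hL hA hd) ?_ ?_ ?_ hF hu
  · exact fun h h' hh => expTime_mono fun ω => voteTime_mono
      (fun i => mul_le_mul_of_nonneg_left hh (hL i).pos.le) ω
  · intro d hd
    obtain ⟨e, he, rfl⟩ := exists_one_lt_pow_eq hd (n := 4) (by norm_num)
    filter_upwards [hM.eventually_expTime_hitTime_le_exp hM' hL hA.nonempty he] with h hh
    exact (expTime_mono (voteTime_le_hitTime rfl)).trans hh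
  · intro d hd
    filter_upwards [hM'.eventually_le_expTime_orderTime hL hA.nonempty.card_pos hd] with h hh
    exact hh.trans (expTime_mono orderTime_le_voteTime)
  · intro d hd
    obtain ⟨e, he, rfl⟩ := exists_one_lt_pow_eq hd (n := 3) (by norm_num)
    filter_upwards [hM'.eventually_expTime_hitTime_le_mul hL A he] with h hh
    exact (expTime_mono (voteTime_le_hitTime rfl)).trans hh

/-- Each sensor of `A` contributes an exponent of at most `d ^ 4 * c * h`; passing to `d ^ 5`
absorbs the number of terms. -/
lemma eventually_expTime_orderTime_le_exp (hM : IIDModel Y q P) (hM' : IIDModel Y q' P')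
    (hL : ∀ i, LRPair (q i) (q' i) (a i)) (hA : IsLowest a A c) {d : ℝ} (hd : 1 < d) :
    ∀ᶠ h : ℝ in atTop, expTime P (orderTime Y A.card fun i => a i * h) ≤
      ENNReal.ofReal (Real.exp (d ^ 5 * c * h)) := by
  have hc : 0 < c := by
    obtain ⟨i, -, rfl⟩ := hA.exists_eq
    exact (hL i).pos
  have hκ : 0 < (d ^ 5 - d ^ 4) * c := by
    have : (d ^ 5 - d ^ 4) * c = d ^ 4 * (d - 1) * c := by ring
    rw [this]
    exact mul_pos (mul_pos (by positivity) (by linarith)) hc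
  have hlim : Tendsto (fun h : ℝ => Real.exp ((d ^ 5 - d ^ 4) * c * h)) atTop atTop :=
    Real.tendsto_exp_atTop.comp (tendsto_id.const_mul_atTop hκ)
  have hall : ∀ᶠ h : ℝ in atTop, ∀ i ∈ A, expTime P (hitTime Y {i} fun i => a i * h) ≤
      ENNReal.ofReal (Real.exp (d ^ 4 * a i * h)) := by
    rw [Filter.eventually_all_finset]
    intro i _
    simpa using hM.eventually_expTime_hitTime_le_exp hM' hL (Finset.singleton_nonempty i) hd
  filter_upwards [hall, hlim.eventually_ge_atTop (A.card : ℝ), eventually_ge_atTop 0]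
    with h h1 h2 h3
  calc expTime P (orderTime Y A.card fun i => a i * h)
      ≤ ∑ i ∈ A, ENNReal.ofReal (Real.exp (d ^ 4 * c * h)) := by
        refine (expTime_mono (orderTime_le_sum_hitTime rfl hA.nonempty.card_pos)).trans ?_
        have hsum : ∀ ω, ((∑ i ∈ A, hitTime Y {i} (fun i => a i * h) ω : ℕ∞) : ℝ≥0∞) =
            ∑ i ∈ A, (hitTime Y {i} (fun i => a i * h) ω : ℝ≥0∞) := fun ω =>
          map_sum ENat.toENNRealRingHom _ A
        unfold expTime
        simp_rw [hsum]
        rw [lintegral_finsetSum A fun i _ => hM.measurable_hitTime {i} _]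
        refine Finset.sum_le_sum fun i hi => (h1 i hi).trans ?_
        refine ENNReal.ofReal_le_ofReal (Real.exp_le_exp.2 ?_)
        have := hA.le i hi
        gcongr
    _ ≤ _ := by
        rw [Finset.sum_const, nsmul_eq_mul, ← ENNReal.ofReal_natCast,
          ← ENNReal.ofReal_mul (by positivity)]
        refine ENNReal.ofReal_le_ofReal ?_
        calc _ ≤ Real.exp ((d ^ 5 - d ^ 4) * c * h) * Real.exp (d ^ 4 * c * h) := by gcongr
          _ = _ := by rw [← Real.exp_add]; ring_nf

lemma orderTime_asymptotics (hM : IIDModel Y q P) (hM' : IIDModel Y q' P')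
    (hL : ∀ i, LRPair (q i) (q' i) (a i)) (hA : IsLowest a A c) (hF : F ≤ atTop)
    (hu : ∀ᶠ γ in F, expTime P (orderTime Y A.card fun i => a i * u γ) = ENNReal.ofReal γ) :
    u ~[F] (fun γ => Real.log γ / c) ∧
      (∀ᶠ γ in F, expTime P' (orderTime Y A.card fun i => a i * u γ) < ⊤) ∧
      (fun γ => (expTime P' (orderTime Y A.card fun i => a i * u γ)).toReal)
        ~[F] fun γ => Real.log γ / c := by
  have hc : 0 < c := by
    obtain ⟨i, -, rfl⟩ := hA.exists_eq
    exact (hL i).pos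
  refine threshold_and_delay_asymptotics
    (T := fun h => expTime P (orderTime Y A.card fun i => a i * h))
    (D := fun h => expTime P' (orderTime Y A.card fun i => a i * h)) hc ?_
    (fun d hd => hM.eventually_exp_le_expTime_orderTime hL hA hd) ?_
    (fun d hd => hM'.eventually_le_expTime_orderTime hL hA.nonempty.card_pos hd) ?_ hF hu
  · exact fun h h' hh => expTime_mono fun ω => orderTime_mono
      (fun i => mul_le_mul_of_nonneg_left hh (hL i).pos.le) ω
  · intro d hd
    obtain ⟨e, he, rfl⟩ := exists_one_lt_pow_eq hd (n := 5) (by norm_num)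
    exact hM.eventually_expTime_orderTime_le_exp hM' hL hA he
  · intro d hd
    obtain ⟨e, he, rfl⟩ := exists_one_lt_pow_eq hd (n := 3) (by norm_num)
    filter_upwards [hM'.eventually_expTime_hitTime_le_mul hL A he] with h hh
    exact (expTime_mono fun ω => (orderTime_le_voteTime ω).trans (voteTime_le_hitTime rfl ω)).trans hh

end IIDModel

end HetQCD

/-- The limit `γ → ∞` is taken along an arbitrary filter `F ≤ atTop` (for example `F = atTop`), so
that it also makes sense when the equations for the thresholds are solvable for some `γ` only. -/
theorem corollary1 {L : ℕ} (N : Fin L → ℕ)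
    {S : Fin L → Type*} [∀ l, MeasurableSpace (S l)]
    (f g : ∀ l, Measure (S l))
    [∀ l, IsProbabilityMeasure (f l)] [∀ l, IsProbabilityMeasure (g l)]
    (hKL_pos : ∀ l, klDiv (g l) (f l) ≠ 0) (hKL_fin : ∀ l, klDiv (g l) (f l) ≠ ⊤)
    (hKL_mono : Monotone (HetQCD.KL f g))
    {Ω : Type*} [MeasurableSpace Ω]
    (X : ∀ i : HetQCD.Sensor N, ℕ → Ω → S i.1)
    (P : ℕ∞ → Measure Ω) (hP : ∀ ν, HetQCD.IsChangeModel f g X ν (P ν))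
    (M : Finset.Icc 1 (∑ l, N l))
    (F : Filter ℝ) (hF : F ≤ atTop) :
    (∀ h₁ : ℝ → ℝ,
      (∀ᶠ γ in F, HetQCD.expTime (P ⊤)
        (HetQCD.alarmTime f g X M (fun l => HetQCD.KL f g l * h₁ γ)) = ENNReal.ofReal γ) →
      h₁ ~[F] (fun γ => Real.log γ / HetQCD.KL f g (HetQCD.lam N M)) ∧
      (∀ᶠ γ in F, HetQCD.expTime (P 0)
        (HetQCD.alarmTime f g X M (fun l => HetQCD.KL f g l * h₁ γ)) < ⊤) ∧
      (fun γ => (HetQCD.expTime (P 0)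
        (HetQCD.alarmTime f g X M (fun l => HetQCD.KL f g l * h₁ γ))).toReal)
        ~[F] (fun γ => Real.log γ / HetQCD.KL f g (HetQCD.lam N M))) ∧
    (∀ h₂ : ℝ → ℝ,
      (∀ᶠ γ in F, HetQCD.expTime (P ⊤)
        (HetQCD.votingTime f g X M (fun l => HetQCD.KL f g l * h₂ γ)) = ENNReal.ofReal γ) →
      h₂ ~[F] (fun γ => Real.log γ /
        ∑ m : Finset.Icc 1 (∑ l, N l) with m ≤ M, HetQCD.KL f g (HetQCD.lam N m)) ∧
      (∀ᶠ γ in F, HetQCD.expTime (P 0)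
        (HetQCD.votingTime f g X M (fun l => HetQCD.KL f g l * h₂ γ)) < ⊤) ∧
      (fun γ => (HetQCD.expTime (P 0)
        (HetQCD.votingTime f g X M (fun l => HetQCD.KL f g l * h₂ γ))).toReal)
        ~[F] (fun γ => Real.log γ /
          ∑ m : Finset.Icc 1 (∑ l, N l) with m ≤ M, HetQCD.KL f g (HetQCD.lam N m))) := by
  have hLR : ∀ i : HetQCD.Sensor N, HetQCD.LRPair ((f i.1).map ((g i.1).rnDeriv (f i.1)))
      ((g i.1).map ((g i.1).rnDeriv (f i.1))) (HetQCD.KL f g i.1) := fun i =>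
    HetQCD.lrPair_rnDeriv (hKL_pos i.1) (hKL_fin i.1)
  have hM₀ := (hP ⊤).iidModel fun i t => (hP ⊤).law_pre i (t + 1) (by omega) le_top
  have hM₁ := (hP 0).iidModel fun i t => (hP 0).law_post i (t + 1) (by omega)
    (by exact_mod_cast Nat.succ_pos t)
  obtain ⟨A, hcard, hA, hsum⟩ := HetQCD.exists_isLowest N hKL_mono M
  simp_rw [HetQCD.alarmTime_eq, HetQCD.votingTime_eq, ← hcard, ← hsum]
  exact ⟨fun h₁ hh => hM₀.orderTime_asymptotics hM₁ hLR hA hF hh,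
    fun h₂ hh => hM₀.voteTime_asymptotics hM₁ hLR hA hF hh⟩
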